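/- Fix $a>0$ and let $\mathcal K(x)=\frac{1-e^{-|x|/a}}{|x|}$ on $\mathbb R^3$. Let $D^{1,2}(\mathbb R^3)=\{u\in L^6(\mathbb R^3): |\nabla u|\in L^2(\mathbb R^3)\}$ (weak gradient, real-valued functions), let $$V(f,g)=\int_{\mathbb R^3}\int_{\mathbb R^3}\mathcal K(x-y)f(x)g(y)\,dx\,dy ,$$ $$\mathcal E=\{u\in D^{1,2}(\mathbb R^3): V(u^2,u^2)<+\infty\},\qquad \|u\|_{\mathcal E}=\Big(\|\nabla u\|_2^2+V(u^2,u^2)^{1/2}\Big)^{1/2},$$ and let $\mathcal E_r$ be the subspace of radial functions in $\mathcal E$, with the same norm. Then $\mathcal E_r$ is continuously embedded into $L^\tau(\mathbb R^3)$ for every $\tau\in(18/7,6]$: one has $\mathcal E_r\subset L^\tau(\mathbb R^3)$, and there is a constant $C=C(a,\tau)$ with $\|u\|_\tau\le C\|u\|_{\mathcal E}$ for all $u\in\mathcal E_r$. Moreover, the embedding is compact for every $\tau\in(18/7,6)$: every sequence bounded in $\mathcal E_r$ has a subsequence that converges in $L^\tau(\mathbb R^3)$. -/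

import Mathlib

open MeasureTheory Filter Topology
open scoped ENNReal NNReal ContDiff

/-- Euclidean three-dimensional space. -/
abbrev R3 : Type := EuclideanSpace ℝ (Fin 3)

/-- `G` is a weak (distributional) gradient of `u` on `ℝ³`: both are locally integrable and
`∫ u ∂ᵢφ = - ∫ Gᵢ φ` for every test function `φ ∈ C_c^∞(ℝ³)` and every coordinate `i`. -/
def HasWeakGradient (u : R3 → ℝ) (G : R3 → R3) : Prop :=
  LocallyIntegrable u volume ∧ LocallyIntegrable G volume ∧
    ∀ φ : R3 → ℝ, ContDiff ℝ ∞ φ → HasCompactSupport φ → ∀ i : Fin 3,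
      ∫ x, u x * fderiv ℝ φ x (EuclideanSpace.single i 1) = - ∫ x, G x i * φ x

/-- The weak gradient of `u` (unique up to null sets when it exists; only used for functions that
have one, the value being `0` otherwise). -/
noncomputable def weakGradient (u : R3 → ℝ) : R3 → R3 :=
  open Classical in if h : ∃ G, HasWeakGradient u G then h.choose else 0

/-- The space `D^{1,2}(ℝ³) = {u ∈ L⁶(ℝ³) : |∇u| ∈ L²(ℝ³)}`. -/
def D12 : Set (R3 → ℝ) :=
  {u | MemLp u 6 volume ∧ ∃ G, HasWeakGradient u G ∧ MemLp G 2 volume}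

/-- The Bopp–Podolsky potential `K(x) = (1 - e^{-|x|/a}) / |x|` (the value at the single point
`x = 0` plays no role). -/
noncomputable def bpKernel (a : ℝ) (x : R3) : ℝ := (1 - Real.exp (-‖x‖ / a)) / ‖x‖

/-- The Bopp–Podolsky energy `V(f, g) = ∫∫ K(x - y) f(x) g(y) dx dy` of nonnegative functions,
with values in `[0, ∞]` (`K` is nonnegative). -/
noncomputable def bpEnergy (a : ℝ) (f g : R3 → ℝ≥0∞) : ℝ≥0∞ :=
  ∫⁻ x, ∫⁻ y, ENNReal.ofReal (bpKernel a (x - y)) * f x * g y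

/-- `V(u², u²)` for a real-valued function `u`. -/
noncomputable def bpEnergySq (a : ℝ) (u : R3 → ℝ) : ℝ≥0∞ :=
  bpEnergy a (fun x => ENNReal.ofReal (u x ^ 2)) (fun x => ENNReal.ofReal (u x ^ 2))

/-- The space `𝓔 = {u ∈ D^{1,2}(ℝ³) : V(u², u²) < ∞}`. -/
def spaceE (a : ℝ) : Set (R3 → ℝ) := {u | u ∈ D12 ∧ bpEnergySq a u < ⊤}

/-- The norm `‖u‖_𝓔 = (‖∇u‖₂² + V(u², u²)^{1/2})^{1/2}`. -/
noncomputable def normE (a : ℝ) (u : R3 → ℝ) : ℝ≥0∞ :=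
  (eLpNorm (weakGradient u) 2 volume ^ 2 + bpEnergySq a u ^ (1 / 2 : ℝ)) ^ (1 / 2 : ℝ)

/-- `u` is radial: it agrees almost everywhere with a function of `|x|`. -/
def IsRadial (u : R3 → ℝ) : Prop := ∃ g : ℝ → ℝ, u =ᵐ[volume] fun x => g ‖x‖

/-- The space `𝓔_r` of radial functions in `𝓔`. -/
def spaceEr (a : ℝ) : Set (R3 → ℝ) := {u | u ∈ spaceE a ∧ IsRadial u}

/-- The function space `S`, with norm `N`, is continuously embedded into `L^τ(ℝ³)`: it is contained
in `L^τ(ℝ³)` and the inclusion, which is linear, is bounded. -/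
def ContinuouslyEmbedsInLp (S : Set (R3 → ℝ)) (N : (R3 → ℝ) → ℝ≥0∞) (τ : ℝ) : Prop :=
  (∀ u ∈ S, MemLp u (ENNReal.ofReal τ) volume) ∧
    ∃ C : ℝ≥0, ∀ u ∈ S, eLpNorm u (ENNReal.ofReal τ) volume ≤ C * N u

/-- The function space `S`, with norm `N`, is compactly embedded into `L^τ(ℝ³)`: it is continuously
embedded, and every `N`-bounded sequence in `S` has a subsequence that converges in `L^τ(ℝ³)`. -/
def CompactlyEmbedsInLp (S : Set (R3 → ℝ)) (N : (R3 → ℝ) → ℝ≥0∞) (τ : ℝ) : Prop :=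
  ContinuouslyEmbedsInLp S N τ ∧
    ∀ u : ℕ → R3 → ℝ, (∀ n, u n ∈ S) → (∃ M : ℝ≥0, ∀ n, N (u n) ≤ M) →
      ∃ (k : ℕ → ℕ) (w : R3 → ℝ), StrictMono k ∧ MemLp w (ENNReal.ofReal τ) volume ∧
        Tendsto (fun n => eLpNorm (u (k n) - w) (ENNReal.ofReal τ) volume) atTop (𝓝 0)

/-! Everything is reduced to the profile `g` of a radial `u(x) = g(|x|)`, which is absolutely
continuous on compact subintervals of `(0, ∞)`, with a derivative `γ` satisfying `∫ t² γ² dt ≤ D²`,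
where `D` is a multiple of `‖∇u‖₂`.

The Bopp–Podolsky energy enters only through `K(z) ≥ 1/(a + |z|)`. Restricting both variables to a
ball gives `(∫_{B_R} u²)² ≤ (a + 2R) V(u², u²)`, and summing over dyadic shells gives `∫_{|x| ≥ 1}
u² |x|^{-1/2-ε} ≤ C V^{1/2}` for each `ε > 0`; for the profile this bounds `∫_1^∞ g² t^{3/2-ε} dt`.

Combined with the gradient, `g(s)² ≤ 2 ∫_s^∞ |g γ|` and Cauchy–Schwarz yield the decay `g(s)² ≤ C N²
s^{-7/4+ε/2}` for `s ≥ 1`, where `N` is the `𝓔`-norm. Writing `|g|^τ = (g²)^{(τ-2)/2} g²`, the first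
factor is dominated by the weight `t^{-1/2-ε}` with a power of `R` to spare on `t ≥ R` as soon as
`(7/8)(τ - 2) > 1/2` and `ε` is small. This is the threshold `τ > 18/7`, and it makes the `L^τ`
tails uniformly small (`exists_eLpNorm_tail_le`).

On bounded sets, Hölder reduces `L^τ` to `L⁶`. The radial Sobolev inequality follows from `t g² ≤
D²` and Hardy's inequality `∫ g² ≤ 6 D²`, as `g⁶ t² = (t g²)² g²`. Head and tail together give the
continuous embedding.

For compactness, bounded profiles are locally equicontinuous and bounded at each radius, so a
subsequence converges at every positive radius. Vitali's theorem upgrades this to `L^τ`: the `L⁶`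
bound with `τ < 6` gives uniform integrability, and the tail estimate gives tightness. -/

/-- Cauchy–Schwarz inequality for lower Lebesgue integrals, squared form. -/
theorem lintegral_mul_sq_le {α : Type*} [MeasurableSpace α] {μ : Measure α} {f g : α → ℝ≥0∞}
    (hf : AEMeasurable f μ) (hg : AEMeasurable g μ) :
    (∫⁻ x, f x * g x ∂μ) ^ 2 ≤ (∫⁻ x, f x ^ 2 ∂μ) * ∫⁻ x, g x ^ 2 ∂μ := by
  have h := ENNReal.lintegral_mul_le_Lp_mul_Lq μ Real.HolderConjugate.two_two hf hg
  have h2 : ∀ X : ℝ≥0∞, (X ^ (1 / 2 : ℝ)) ^ 2 = X := fun X => by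
    rw [← ENNReal.rpow_natCast, ← ENNReal.rpow_mul]; norm_num
  calc _ ≤ _ := pow_le_pow_left₀ zero_le h 2
    _ = _ := by simp only [mul_pow, h2, ENNReal.rpow_two]

theorem Real.sq_le_mul_sq_of_enorm {y X : ℝ} {D : ℝ≥0} (hX : 0 ≤ X)
    (h : ‖y‖ₑ ^ 2 ≤ ENNReal.ofReal X * (D : ℝ≥0∞) ^ 2) : y ^ 2 ≤ X * D ^ 2 := by
  have hD : ENNReal.ofReal ((D : ℝ) ^ 2) = (D : ℝ≥0∞) ^ 2 := by
    rw [ENNReal.ofReal_pow D.coe_nonneg, ENNReal.ofReal_coe_nnreal]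
  rw [← ENNReal.ofReal_le_ofReal_iff (by positivity), ENNReal.ofReal_mul hX, ← sq_abs y,
    ENNReal.ofReal_pow (abs_nonneg _), hD, ← Real.enorm_eq_ofReal_abs]
  exact h

/-! ### One-dimensional estimates for radial profiles -/

/-- `γ` is measurable and `∫ t² γ(t)² dt ≤ D²` on `(0, ∞)`. -/
structure RadialEnergyLE (γ : ℝ → ℝ) (D : ℝ≥0) : Prop where
  measurable : Measurable γ
  energy : ∫⁻ t in Set.Ioi 0, (ENNReal.ofReal t * ‖γ t‖ₑ) ^ 2 ≤ (D : ℝ≥0∞) ^ 2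

/-- `g` is an absolutely continuous function on `(0, ∞)` with derivative `γ`, and
`∫ t² γ(t)² dt ≤ D²`. -/
structure RadialProfile (g γ : ℝ → ℝ) (D : ℝ≥0) : Prop extends RadialEnergyLE γ D where
  ftc : ∀ s r, 0 < s → s ≤ r → g r - g s = ∫ t in s..r, γ t

theorem lintegral_Ioc_inv_sq {s r : ℝ} (hs : 0 < s) (hr : s ≤ r) :
    ∫⁻ t in Set.Ioc s r, ENNReal.ofReal t⁻¹ ^ 2 = ENNReal.ofReal (s⁻¹ - r⁻¹) := by
  have h0 : ∀ t ∈ Set.uIcc s r, t ≠ 0 := fun t ht => by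
    rw [Set.uIcc_of_le hr] at ht; exact (hs.trans_le ht.1).ne'
  have hc : ContinuousOn (fun t : ℝ => (t ^ 2)⁻¹) (Set.uIcc s r) :=
    (continuousOn_id.pow 2).inv₀ fun t ht => pow_ne_zero 2 (h0 t ht)
  have h1 : ∫ t in s..r, (t ^ 2)⁻¹ = s⁻¹ - r⁻¹ := by
    have := intervalIntegral.integral_eq_sub_of_hasDerivAt (f := fun t : ℝ => -t⁻¹)
      (f' := fun t => (t ^ 2)⁻¹) (fun t ht => (hasDerivAt_inv (h0 t ht)).fun_neg.congr_deriv (by ring))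
      hc.intervalIntegrable
    rw [this]; ring
  rw [← h1, intervalIntegral.integral_of_le hr, ofReal_integral_eq_lintegral_ofReal]
  · refine setLIntegral_congr_fun measurableSet_Ioc fun t ht => ?_
    have : 0 ≤ t⁻¹ := inv_nonneg.2 (hs.trans ht.1).le
    simp only [← inv_pow]
    rw [ENNReal.ofReal_pow this]
  · exact hc.intervalIntegrable.1
  · exact .of_forall fun t => by positivity

namespace RadialEnergyLE

variable {γ : ℝ → ℝ} {D : ℝ≥0}

theorem lintegral_mul_sq_le (h : RadialEnergyLE γ D) {S : Set ℝ} (hS : S ⊆ Set.Ioi 0)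
    {k : ℝ → ℝ≥0∞} (hk : AEMeasurable k (volume.restrict S)) :
    (∫⁻ t in S, k t * (ENNReal.ofReal t * ‖γ t‖ₑ)) ^ 2 ≤ (∫⁻ t in S, k t ^ 2) * (D : ℝ≥0∞) ^ 2 := by
  have hm := h.measurable
  refine (_root_.lintegral_mul_sq_le hk (by fun_prop)).trans ?_
  gcongr
  exact (lintegral_mono_set hS).trans h.energy

/-- Cauchy–Schwarz applied to `|γ| = t⁻¹ · (t |γ|)`, with `∫ t⁻² = s⁻¹ - r⁻¹`. It gives both the
local integrability of `γ` and the modulus of continuity of the profile. -/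
theorem lintegral_enorm_sq_le (h : RadialEnergyLE γ D) {s r : ℝ} (hs : 0 < s) (hr : s ≤ r) :
    (∫⁻ t in Set.Ioc s r, ‖γ t‖ₑ) ^ 2 ≤ ENNReal.ofReal (s⁻¹ - r⁻¹) * (D : ℝ≥0∞) ^ 2 := by
  have := h.lintegral_mul_sq_le (S := Set.Ioc s r) (fun t ht => hs.trans ht.1)
    (k := fun t => ENNReal.ofReal t⁻¹) (by fun_prop)
  rw [lintegral_Ioc_inv_sq hs hr] at this
  convert this using 2
  refine setLIntegral_congr_fun measurableSet_Ioc fun t ht => ?_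
  have ht0 : 0 < t := hs.trans ht.1
  rw [← mul_assoc, ← ENNReal.ofReal_mul (by positivity), inv_mul_cancel₀ ht0.ne']
  simp

theorem intervalIntegrable (h : RadialEnergyLE γ D) {s r : ℝ} (hs : 0 < s) (hr : s ≤ r) :
    IntervalIntegrable γ volume s r := by
  rw [intervalIntegrable_iff_integrableOn_Ioc_of_le hr]
  refine ⟨h.measurable.aestronglyMeasurable, ?_⟩
  rw [hasFiniteIntegral_iff_enorm]
  by_contra hc
  have := h.lintegral_enorm_sq_le hs hr
  rw [not_lt_top_iff.1 hc] at this
  simp only [ne_eq, OfNat.ofNat_ne_zero, not_false_eq_true, ENNReal.top_pow, top_le_iff] at this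
  exact (ENNReal.mul_lt_top ENNReal.ofReal_lt_top (by simp)).ne this

end RadialEnergyLE

namespace RadialProfile

variable {g γ : ℝ → ℝ} {D : ℝ≥0}

theorem abs_sub_le (h : RadialProfile g γ D) {s r : ℝ} (hs : 0 < s) (hr : s ≤ r) :
    |g r - g s| ≤ D * √(s⁻¹ - r⁻¹) := by
  have hsr : 0 ≤ s⁻¹ - r⁻¹ := sub_nonneg.2 (inv_anti₀ hs hr)
  have h1 : ‖g r - g s‖ₑ ≤ ∫⁻ t in Set.Ioc s r, ‖γ t‖ₑ := by
    rw [h.ftc s r hs hr, intervalIntegral.integral_of_le hr]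
    exact enorm_integral_le_lintegral_enorm _
  have h2 : ‖g r - g s‖ₑ ^ 2 ≤ ENNReal.ofReal (s⁻¹ - r⁻¹) * (D : ℝ≥0∞) ^ 2 :=
    (pow_le_pow_left₀ zero_le h1 2).trans (h.lintegral_enorm_sq_le hs hr)
  have h3 := Real.sq_le_mul_sq_of_enorm hsr h2
  refine abs_le_of_sq_le_sq ?_ (by positivity)
  rw [mul_pow, Real.sq_sqrt hsr]
  linarith

/-- The fundamental theorem of calculus for the absolutely continuous function `k g²`. The weight `k
t = t` serves Hardy's inequality, and `k = 1` the decay at infinity. -/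
theorem sub_eq_integral_sq (h : RadialProfile g γ D) {s r : ℝ} (hs : 0 < s) (hr : s ≤ r)
    {k k' : ℝ → ℝ} (hk : ContDiff ℝ 1 k) (hk' : ∀ t, HasDerivAt k (k' t) t) :
    k r * g r ^ 2 - k s * g s ^ 2 = ∫ t in s..r, (k' t * g t ^ 2 + 2 * (k t * (g t * γ t))) := by
  have hi := h.intervalIntegrable hs hr
  set G : ℝ → ℝ := fun x => ∫ v in s..x, γ v with hG
  have hgG : ∀ t ∈ Set.uIcc s r, g t = g s + G t := fun t ht => by
    rw [Set.uIcc_of_le hr] at ht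
    linarith [h.ftc s t hs ht.1]
  have hac : AbsolutelyContinuousOnInterval (fun t => g s + G t) s r :=
    (contDiff_const.contDiffOn.absolutelyContinuousOnInterval).fun_add
      (hi.absolutelyContinuousOnInterval_intervalIntegral (c := s) (by simp))
  have hac2 : AbsolutelyContinuousOnInterval (fun t => k t * ((g s + G t) * (g s + G t))) s r :=
    (hk.contDiffOn.absolutelyContinuousOnInterval).fun_mul (hac.fun_mul hac)
  have := hac2.integral_deriv_eq_sub
  rw [← hgG r (by simp), ← hgG s (by simp)] at this
  rw [sq, sq, ← this]
  refine intervalIntegral.integral_congr_ae ?_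
  filter_upwards [hi.ae_hasDerivAt_integral] with x hx hxm
  have hxm' := Set.uIoc_subset_uIcc hxm
  have hd := (hx hxm' s (by simp)).const_add (g s)
  have hd2 := (hk' x).fun_mul (hd.fun_mul hd)
  rw [hd2.deriv, hgG x hxm']
  ring

theorem continuousOn (h : RadialProfile g γ D) {s r : ℝ} (hs : 0 < s) (hr : s ≤ r) :
    ContinuousOn g (Set.uIcc s r) := by
  have hi := h.intervalIntegrable hs hr
  have := (hi.absolutelyContinuousOnInterval_intervalIntegral (c := s) (by simp)).continuousOn
  refine (this.const_add (g s)).congr fun t ht => ?_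
  rw [Set.uIcc_of_le hr] at ht
  simp only
  linarith [h.ftc s t hs ht.1]

theorem continuousOn_Ioi (h : RadialProfile g γ D) : ContinuousOn g (Set.Ioi 0) := fun t ht => by
  have ht' : 0 < t := ht
  refine ((h.continuousOn (s := t / 2) (r := 2 * t) (by positivity) (by linarith)).continuousAt ?_).continuousWithinAt
  rw [Set.uIcc_of_le (by linarith)]
  exact Icc_mem_nhds (by linarith) (by linarith)

theorem aemeasurable (h : RadialProfile g γ D) {S : Set ℝ} (hS : S ⊆ Set.Ioi 0) :
    AEMeasurable g (volume.restrict S) :=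
  (h.continuousOn_Ioi.aemeasurable measurableSet_Ioi).mono_set hS

/-- Compare `g s` with `g r` at a far radius where `g` is small; the modulus of continuity is at
most `D √(s⁻¹)` uniformly in `r`. The hypothesis `h0`, smallness along some radii going to infinity,
stands in for a limit at infinity. -/
theorem sq_le_div (h : RadialProfile g γ D) (h0 : ∀ ε > 0, ∀ s, ∃ r, s ≤ r ∧ |g r| ≤ ε)
    {s : ℝ} (hs : 0 < s) : g s ^ 2 ≤ D ^ 2 / s := by
  have key : |g s| ≤ D * √(s⁻¹) := by
    refine le_of_forall_pos_le_add fun ε hε => ?_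
    obtain ⟨r, hr, hgr⟩ := h0 ε hε s
    have h1 := h.abs_sub_le hs hr
    have h2 : √(s⁻¹ - r⁻¹) ≤ √(s⁻¹) :=
      Real.sqrt_le_sqrt (by linarith [inv_pos.2 (hs.trans_le hr)])
    have h3 := mul_le_mul_of_nonneg_left h2 D.2
    have := abs_sub_abs_le_abs_sub (g s) (g r)
    rw [abs_sub_comm] at this
    simp only [NNReal.val_eq_coe] at h3
    linarith
  calc g s ^ 2 = |g s| ^ 2 := (sq_abs _).symm
    _ ≤ (D * √(s⁻¹)) ^ 2 := by gcongr
    _ = D ^ 2 / s := by rw [mul_pow, Real.sq_sqrt (by positivity)]; rfl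

/-- Hardy's inequality, by integrating `(t g²)' = g² + 2 t g γ`. The boundary term at `r` is at most
`D²` by `sq_le_div`, and the one at `s` has a favourable sign. Cauchy–Schwarz and Young bound the
cross term by `X / 2 + 2 D²`, so half of `X` is absorbed. -/
theorem integral_sq_le (h : RadialProfile g γ D) (h0 : ∀ ε > 0, ∀ s, ∃ r, s ≤ r ∧ |g r| ≤ ε)
    {s r : ℝ} (hs : 0 < s) (hr : s ≤ r) : ∫ t in s..r, g t ^ 2 ≤ 6 * D ^ 2 := by
  have hi := h.intervalIntegrable hs hr
  have hc := h.continuousOn hs hr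
  have hint1 : IntervalIntegrable (fun t => g t ^ 2) volume s r := (hc.pow 2).intervalIntegrable
  have hint2 : IntervalIntegrable (fun t => t * (g t * γ t)) volume s r :=
    (hi.continuousOn_mul hc).continuousOn_mul continuousOn_id
  have e1 := h.sub_eq_integral_sq hs hr contDiff_id (fun t => hasDerivAt_id t)
  simp only [id, one_mul] at e1
  rw [intervalIntegral.integral_add hint1 (hint2.const_mul 2),
    intervalIntegral.integral_const_mul] at e1
  have hrg : r * g r ^ 2 ≤ D ^ 2 := by
    have := h.sq_le_div h0 (hs.trans_le hr)
    rwa [le_div_iff₀ (hs.trans_le hr), mul_comm] at this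
  have hsg : 0 ≤ s * g s ^ 2 := by positivity
  set X := ∫ t in s..r, g t ^ 2
  set Y := ∫ t in s..r, t * (g t * γ t)
  have hX : ∫⁻ t in Set.Ioc s r, ‖g t‖ₑ ^ 2 = ENNReal.ofReal X := by
    rw [show X = _ from intervalIntegral.integral_of_le hr, ofReal_integral_eq_lintegral_ofReal hint1.1
      (.of_forall fun t => by positivity)]
    refine lintegral_congr fun t => ?_
    rw [← sq_abs, ENNReal.ofReal_pow (abs_nonneg _), Real.enorm_eq_ofReal_abs]
  have hX0 : 0 ≤ X := intervalIntegral.integral_nonneg hr fun t _ => by positivity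
  have hY : ‖Y‖ₑ ^ 2 ≤ ENNReal.ofReal X * (D : ℝ≥0∞) ^ 2 := by
    have hS : Set.Ioc s r ⊆ Set.Ioi 0 := fun t ht => hs.trans ht.1
    have := h.lintegral_mul_sq_le (S := Set.Ioc s r) hS (k := fun t => ‖g t‖ₑ)
      (h.aemeasurable hS).enorm
    rw [hX] at this
    refine le_trans ?_ this
    gcongr
    rw [show Y = _ from intervalIntegral.integral_of_le hr]
    refine (enorm_integral_le_lintegral_enorm _).trans_eq ?_
    refine setLIntegral_congr_fun measurableSet_Ioc fun t ht => ?_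
    simp only [enorm_mul]
    rw [Real.enorm_of_nonneg (hS ht).le]
    ring
  have hY' := Real.sq_le_mul_sq_of_enorm hX0 hY
  have hY2 : |2 * Y| ≤ X / 2 + 2 * D ^ 2 := by
    refine abs_le_of_sq_le_sq ?_ (by positivity)
    nlinarith [sq_nonneg (X / 2 - 2 * (D : ℝ) ^ 2)]
  have := neg_abs_le (2 * Y)
  linarith

/-- Integrate `(g²)' = 2 g γ` from `s` to a far radius and apply Cauchy–Schwarz to `(t⁻¹ g)(t γ)`.
On `t ≥ s`, the factor `t⁻² = t^{-7/2+ε} t^{3/2-ε}` is at most `s^{-7/2+ε}` times the weight; its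
square root is the stated rate. -/
theorem sq_le_of_weighted (h : RadialProfile g γ D) (h0 : ∀ ε > 0, ∀ s, ∃ r, s ≤ r ∧ |g r| ≤ ε)
    {ε : ℝ} (hε : ε ≤ 7 / 2) {W : ℝ} (hW0 : 0 ≤ W)
    (hW : ∫⁻ t in Set.Ioi 1, ENNReal.ofReal (g t ^ 2 * t ^ (3 / 2 - ε)) ≤ ENNReal.ofReal W)
    {s : ℝ} (hs : 1 ≤ s) :
    g s ^ 2 ≤ 2 * D * √W * s ^ (-(7 / 4) + ε / 2) := by
  have hs0 : 0 < s := one_pos.trans_le hs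
  refine le_of_forall_pos_le_add fun δ hδ => ?_
  obtain ⟨r, hr, hgr⟩ := h0 (√δ) (Real.sqrt_pos.2 hδ) s
  have hi := h.intervalIntegrable hs0 hr
  have hc := h.continuousOn hs0 hr
  have e1 := h.sub_eq_integral_sq hs0 hr (k := fun _ => 1) contDiff_const (fun t => hasDerivAt_const t 1)
  simp only [one_mul, zero_mul, zero_add, intervalIntegral.integral_const_mul] at e1
  set Y := ∫ t in s..r, g t * γ t
  have hS : Set.Ioc s r ⊆ Set.Ioi 0 := fun t ht => hs0.trans ht.1
  have hm : AEMeasurable (fun t => ENNReal.ofReal t⁻¹ * ‖g t‖ₑ) (volume.restrict (Set.Ioc s r)) :=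
    AEMeasurable.mul (by fun_prop) (h.aemeasurable hS).enorm
  have hY := h.lintegral_mul_sq_le (S := Set.Ioc s r) hS hm
  have hY1 : ‖Y‖ₑ ≤ ∫⁻ t in Set.Ioc s r, ENNReal.ofReal t⁻¹ * ‖g t‖ₑ * (ENNReal.ofReal t * ‖γ t‖ₑ) := by
    rw [show Y = _ from intervalIntegral.integral_of_le hr]
    refine (enorm_integral_le_lintegral_enorm _).trans_eq ?_
    refine setLIntegral_congr_fun measurableSet_Ioc fun t ht => ?_
    have ht0 : 0 < t := hS ht
    have : ENNReal.ofReal t⁻¹ * ENNReal.ofReal t = 1 := by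
      rw [← ENNReal.ofReal_mul (by positivity), inv_mul_cancel₀ ht0.ne', ENNReal.ofReal_one]
    calc ‖g t * γ t‖ₑ = (ENNReal.ofReal t⁻¹ * ENNReal.ofReal t) * (‖g t‖ₑ * ‖γ t‖ₑ) := by
          rw [this, one_mul, enorm_mul]
      _ = _ := by ring
  have hY2 : ∫⁻ t in Set.Ioc s r, (ENNReal.ofReal t⁻¹ * ‖g t‖ₑ) ^ 2 ≤
      ENNReal.ofReal (s ^ (-(7 / 2) + ε)) * ENNReal.ofReal W := by
    calc _ ≤ ∫⁻ t in Set.Ioc s r, ENNReal.ofReal (s ^ (-(7 / 2) + ε)) *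
            ENNReal.ofReal (g t ^ 2 * t ^ (3 / 2 - ε)) := by
          refine setLIntegral_mono' measurableSet_Ioc fun t ht => ?_
          have ht0 : 0 < t := hS ht
          rw [Real.enorm_eq_ofReal_abs, ← ENNReal.ofReal_mul (by positivity),
            ← ENNReal.ofReal_pow (by positivity), ← ENNReal.ofReal_mul (by positivity)]
          refine ENNReal.ofReal_le_ofReal ?_
          have h1 : t ^ (-(7 / 2) + ε) ≤ s ^ (-(7 / 2) + ε) :=
            Real.rpow_le_rpow_of_nonpos hs0 ht.1.le (by linarith)
          have h2 : t⁻¹ ^ 2 = t ^ (-(7 / 2) + ε) * t ^ (3 / 2 - ε) := by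
            rw [← Real.rpow_add ht0, inv_pow, ← Real.rpow_natCast, ← Real.rpow_neg ht0.le]
            norm_num
          calc (t⁻¹ * |g t|) ^ 2 = t ^ (-(7 / 2) + ε) * (g t ^ 2 * t ^ (3 / 2 - ε)) := by
                rw [mul_pow, h2, sq_abs]; ring
            _ ≤ _ := by gcongr
      _ = ENNReal.ofReal (s ^ (-(7 / 2) + ε)) * ∫⁻ t in Set.Ioc s r,
            ENNReal.ofReal (g t ^ 2 * t ^ (3 / 2 - ε)) := lintegral_const_mul' _ _ (by simp)
      _ ≤ _ := by
          gcongr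
          exact (lintegral_mono_set fun t ht => hs.trans_lt ht.1).trans hW
  have hY3 : ‖Y‖ₑ ^ 2 ≤ ENNReal.ofReal (s ^ (-(7 / 2) + ε)) * ENNReal.ofReal W * (D : ℝ≥0∞) ^ 2 :=
    (pow_le_pow_left₀ zero_le hY1 2).trans (hY.trans (by gcongr))
  have hY4 : Y ^ 2 ≤ s ^ (-(7 / 2) + ε) * W * D ^ 2 :=
    Real.sq_le_mul_sq_of_enorm (by positivity) (by rwa [ENNReal.ofReal_mul (by positivity)])
  have hY5 : |Y| ≤ D * √W * s ^ (-(7 / 4) + ε / 2) := by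
    refine (abs_le_of_sq_le_sq ?_ (by positivity))
    rw [mul_pow, mul_pow, Real.sq_sqrt hW0, ← Real.rpow_natCast (s ^ _), ← Real.rpow_mul hs0.le]
    have : (-(7 / 4) + ε / 2) * (2 : ℕ) = -(7 / 2) + ε := by push_cast; ring
    rw [this]
    linarith
  have hgr2 : g r ^ 2 ≤ δ := by
    rw [← Real.sq_sqrt hδ.le, ← sq_abs]; gcongr
  have := neg_abs_le Y
  linarith

/-- Since `g⁶ t² = (t g²)² g²`, the pointwise bound `t g² ≤ D²` reduces the claim to Hardy's
inequality, applied on intervals exhausting `(0, ∞)`. -/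
theorem lintegral_pow_six_le (h : RadialProfile g γ D)
    (h0 : ∀ ε > 0, ∀ s, ∃ r, s ≤ r ∧ |g r| ≤ ε) :
    ∫⁻ t in Set.Ioi 0, ENNReal.ofReal (g t ^ 6 * t ^ 2) ≤ ENNReal.ofReal (6 * D ^ 6) := by
  have hU : Set.Ioi (0 : ℝ) = ⋃ n : ℕ, Set.Ioc ((n + 1 : ℝ)⁻¹) (n + 1) := by
    ext t
    simp only [Set.mem_Ioi, Set.mem_iUnion, Set.mem_Ioc]
    constructor
    · intro ht
      obtain ⟨n, hn⟩ := exists_nat_gt (max t t⁻¹)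
      refine ⟨n, inv_lt_of_inv_lt₀ ht ?_, ?_⟩
      · linarith [le_max_right t t⁻¹]
      · linarith [le_max_left t t⁻¹]
    · rintro ⟨n, h1, h2⟩
      exact (by positivity : (0:ℝ) < (n + 1 : ℝ)⁻¹).trans h1
  have hmono : Monotone fun n : ℕ => Set.Ioc ((n + 1 : ℝ)⁻¹) (n + 1) := fun m n hmn => by
    have : (m : ℝ) ≤ n := by exact_mod_cast hmn
    exact Set.Ioc_subset_Ioc (inv_anti₀ (by positivity) (by linarith)) (by linarith)
  rw [hU, setLIntegral_iUnion_of_directed _ hmono.directed_le]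
  refine iSup_le fun n => ?_
  have hn0 : (0 : ℝ) < (n + 1 : ℝ)⁻¹ := by positivity
  have hn1 : (n + 1 : ℝ)⁻¹ ≤ n + 1 :=
    (inv_le_one_of_one_le₀ (by linarith [n.cast_nonneg (α := ℝ)])).trans (by linarith [n.cast_nonneg (α := ℝ)])
  have hi : IntegrableOn (fun t => g t ^ 2) _ _ := (((h.continuousOn hn0 hn1).pow 2).intervalIntegrable (μ := volume)).1
  calc _ ≤ ∫⁻ t in Set.Ioc ((n + 1 : ℝ)⁻¹) (n + 1), ENNReal.ofReal (D ^ 4) * ENNReal.ofReal (g t ^ 2) := by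
        refine setLIntegral_mono' measurableSet_Ioc fun t ht => ?_
        have ht0 : 0 < t := hn0.trans ht.1
        rw [← ENNReal.ofReal_mul (by positivity)]
        refine ENNReal.ofReal_le_ofReal ?_
        have h1 := h.sq_le_div h0 ht0
        rw [le_div_iff₀ ht0] at h1
        calc g t ^ 6 * t ^ 2 = (g t ^ 2 * t) ^ 2 * g t ^ 2 := by ring
          _ ≤ (D ^ 2) ^ 2 * g t ^ 2 := by gcongr
          _ = _ := by ring
    _ = ENNReal.ofReal (D ^ 4) * ∫⁻ t in Set.Ioc ((n + 1 : ℝ)⁻¹) (n + 1), ENNReal.ofReal (g t ^ 2) :=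
        lintegral_const_mul' _ _ (by simp)
    _ = ENNReal.ofReal (D ^ 4) * ENNReal.ofReal (∫ t in ((n + 1 : ℝ)⁻¹)..(n + 1), g t ^ 2) := by
        rw [intervalIntegral.integral_of_le hn1, ofReal_integral_eq_lintegral_ofReal hi
          (.of_forall fun t => by positivity)]
    _ ≤ ENNReal.ofReal (D ^ 4) * ENNReal.ofReal (6 * D ^ 2) := by
        gcongr
        exact h.integral_sq_le h0 hn0 hn1
    _ = _ := by
        rw [← ENNReal.ofReal_mul (by positivity)]; ring_nf

/-- A profile with `∫ t² g(t)⁶ dt < ∞` takes arbitrarily small values near infinity. -/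
theorem exists_abs_le_of_lintegral_ne_top {g : ℝ → ℝ}
    (h6 : ∫⁻ t in Set.Ioi 0, ENNReal.ofReal (g t ^ 6 * t ^ 2) ≠ ⊤) :
    ∀ ε > 0, ∀ s, ∃ r, s ≤ r ∧ |g r| ≤ ε := by
  intro ε hε s
  by_contra! hc
  refine h6 (top_le_iff.1 ?_)
  calc (⊤ : ℝ≥0∞) = ∫⁻ t in Set.Ici (max s 1), ENNReal.ofReal (ε ^ 6) := by
        rw [setLIntegral_const, Real.volume_Ici, ENNReal.mul_top (by simp; positivity)]
    _ ≤ ∫⁻ t in Set.Ici (max s 1), ENNReal.ofReal (g t ^ 6 * t ^ 2) := by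
        refine setLIntegral_mono' measurableSet_Ici fun t ht => ENNReal.ofReal_le_ofReal ?_
        have h1 := hc t ((le_max_left _ _).trans ht)
        have h2 : 1 ≤ t := (le_max_right _ _).trans ht
        calc ε ^ 6 ≤ |g t| ^ 6 := by gcongr
          _ = g t ^ 6 := by rw [pow_abs, abs_of_nonneg (by positivity)]
          _ ≤ g t ^ 6 * t ^ 2 := le_mul_of_one_le_right (by positivity) (one_le_pow₀ h2)
    _ ≤ _ := lintegral_mono_set fun t ht => one_pos.trans_le ((le_max_right s 1).trans ht)

end RadialProfile

/-! ### Weak derivatives on the half-line -/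

theorem exists_subset_Ioo_of_isCompact {K : Set ℝ} (hK : IsCompact K) (h : K ⊆ Set.Ioi 0) :
    ∃ s R, 0 < s ∧ s ≤ 1 ∧ 1 ≤ R ∧ K ⊆ Set.Ioo s R := by
  -- Adjoining `1` handles an empty `K` and keeps the base point of the primitives inside the
  -- interval.
  have hK1 : IsCompact (insert 1 K) := hK.insert 1
  obtain ⟨m, hm, hm'⟩ := hK1.exists_isLeast ⟨1, by simp⟩
  obtain ⟨M, hM, hM'⟩ := hK1.exists_isGreatest ⟨1, by simp⟩
  have hm0 : 0 < m := by
    rcases hm with rfl | hm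
    · exact one_pos
    · exact h hm
  have h1 : m ≤ 1 := hm' (by simp)
  have h2 : 1 ≤ M := hM' (by simp)
  refine ⟨m / 2, M + 1, by positivity, by linarith, by linarith, fun t ht => ⟨?_, ?_⟩⟩
  · linarith [hm' (Set.mem_insert_of_mem 1 ht)]
  · linarith [hM' (Set.mem_insert_of_mem 1 ht)]

theorem integral_primitive_mul_deriv {γ : ℝ → ℝ}
    (hγ : ∀ s r, 0 < s → s ≤ r → IntervalIntegrable γ volume s r)
    {η : ℝ → ℝ} (h1 : ContDiff ℝ ∞ η) (h2 : HasCompactSupport η) (h3 : tsupport η ⊆ Set.Ioi 0) :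
    ∫ t, (∫ v in (1 : ℝ)..t, γ v) * deriv η t = -∫ t, γ t * η t := by
  obtain ⟨s, R, hs, hs1, hR, hK⟩ := exists_subset_Ioo_of_isCompact h2 h3
  have hsR : s ≤ R := hs1.trans hR
  have hi := hγ s R hs hsR
  have hac := hi.absolutelyContinuousOnInterval_intervalIntegral (c := 1)
    (by rw [Set.uIcc_of_le hsR]; exact ⟨hs1, hR⟩)
  have hη0 : ∀ t, t ∉ Set.Ioo s R → η t = 0 := fun t ht =>
    image_eq_zero_of_notMem_tsupport fun h => ht (hK h)
  have hη1 : ∀ t, t ∉ Set.Ioo s R → deriv η t = 0 := fun t ht =>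
    image_eq_zero_of_notMem_tsupport fun h => ht (hK (tsupport_deriv_subset h))
  have hηac : AbsolutelyContinuousOnInterval η s R :=
    (h1.of_le (by simp)).contDiffOn.absolutelyContinuousOnInterval
  have key := hac.integral_mul_deriv_eq_deriv_mul hηac
  rw [hη0 s (by simp), hη0 R (by simp), mul_zero, mul_zero, sub_zero, zero_sub] at key
  have e1 : ∀ f : ℝ → ℝ, (∀ t, t ∉ Set.Ioo s R → f t = 0) → ∫ t, f t = ∫ t in s..R, f t := by
    intro f hf
    rw [intervalIntegral.integral_of_le hsR, setIntegral_eq_integral_of_forall_compl_eq_zero]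
    exact fun t ht => hf t fun h => ht ⟨h.1, h.2.le⟩
  rw [e1 _ fun t ht => by rw [hη1 t ht, mul_zero], e1 _ fun t ht => by rw [hη0 t ht, mul_zero], key]
  congr 1
  refine intervalIntegral.integral_congr_ae ?_
  filter_upwards [hi.ae_hasDerivAt_integral] with x hx hxm
  rw [(hx (Set.uIoc_subset_uIcc hxm) 1 (by rw [Set.uIcc_of_le hsR]; exact ⟨hs1, hR⟩)).deriv]

/-- Integrate from a point to the left of the support; the zero mean makes the primitive vanish
again to the right of it. -/
theorem exists_contDiff_primitive {χ : ℝ → ℝ} (h1 : ContDiff ℝ ∞ χ) (h2 : HasCompactSupport χ)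
    (h3 : tsupport χ ⊆ Set.Ioi 0) (h4 : ∫ t, χ t = 0) :
    ∃ η : ℝ → ℝ, ContDiff ℝ ∞ η ∧ HasCompactSupport η ∧ tsupport η ⊆ Set.Ioi 0 ∧ deriv η = χ := by
  obtain ⟨s, R, hs, hs1, hR, hK⟩ := exists_subset_Ioo_of_isCompact h2 h3
  have h0 : ∀ t, t ∉ Set.Ioo s R → χ t = 0 := fun t ht =>
    image_eq_zero_of_notMem_tsupport fun h => ht (hK h)
  have hd : ∀ t, HasDerivAt (fun r => ∫ v in s..r, χ v) (χ t) t := fun t =>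
    h1.continuous.integral_hasStrictDerivAt s t |>.hasDerivAt
  have hsupp : Function.support (fun r => ∫ v in s..r, χ v) ⊆ Set.Icc s R := by
    intro r hr
    by_contra hc
    refine hr ?_
    rcases lt_or_ge r s with h | h
    · refine (intervalIntegral.integral_congr (g := fun _ => 0) fun t ht => h0 t ?_).trans (by simp)
      rw [Set.uIcc_of_ge h.le] at ht
      exact fun h' => absurd h'.1 (not_lt.2 ht.2)
    · have hRr : R < r := by
        by_contra h'
        exact hc ⟨h, not_lt.1 h'⟩
      simp only
      rw [intervalIntegral.integral_of_le h, setIntegral_eq_integral_of_forall_compl_eq_zero, h4]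
      exact fun t ht => h0 t fun h' => ht ⟨h'.1, h'.2.le.trans hRr.le⟩
  refine ⟨fun r => ∫ v in s..r, χ v, ?_, HasCompactSupport.of_support_subset_isCompact isCompact_Icc hsupp,
    (closure_minimal hsupp isClosed_Icc).trans fun t ht => hs.trans_le ht.1, funext fun t => (hd t).deriv⟩
  rw [contDiff_infty_iff_deriv]
  refine ⟨fun t => (hd t).differentiableAt, ?_⟩
  rwa [funext fun t => (hd t).deriv]

/-- The lemma of du Bois-Reymond on `(0, ∞)`: a locally integrable function with weak derivative
`γ` is a primitive of `γ`. -/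
theorem ae_eq_const_add_primitive {g γ : ℝ → ℝ} (hg : LocallyIntegrableOn g (Set.Ioi 0))
    (hγ : ∀ s r, 0 < s → s ≤ r → IntervalIntegrable γ volume s r)
    (h : ∀ η : ℝ → ℝ, ContDiff ℝ ∞ η → HasCompactSupport η → tsupport η ⊆ Set.Ioi 0 →
      ∫ t, g t * deriv η t = -∫ t, γ t * η t) :
    ∃ C, ∀ᵐ t, t ∈ Set.Ioi (0 : ℝ) → g t = C + ∫ v in (1 : ℝ)..t, γ v := by
  set Γ : ℝ → ℝ := fun t => ∫ v in (1 : ℝ)..t, γ v with hΓ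
  have hΓc : ContinuousOn Γ (Set.Ioi 0) := by
    intro t ht
    have ht : 0 < t := ht
    have hi := hγ (min (t / 2) 1) (max (2 * t) 1) (by positivity)
      ((min_le_right _ _).trans (le_max_right _ _))
    have := (hi.absolutelyContinuousOnInterval_intervalIntegral (c := 1) (by
      rw [Set.uIcc_of_le ((min_le_right _ _).trans (le_max_right _ _))]; simp)).continuousOn
    refine (this.continuousAt ?_).continuousWithinAt
    rw [Set.uIcc_of_le ((min_le_right _ _).trans (le_max_right _ _))]
    exact Icc_mem_nhds ((min_le_left _ _).trans_lt (by linarith))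
      ((by linarith : t < 2 * t).trans_le (le_max_left _ _))
  have hΓl : LocallyIntegrableOn Γ (Set.Ioi 0) := hΓc.locallyIntegrableOn measurableSet_Ioi
  have hmul : ∀ f : ℝ → ℝ, LocallyIntegrableOn f (Set.Ioi 0) → ∀ φ : ℝ → ℝ, Continuous φ →
      HasCompactSupport φ → tsupport φ ⊆ Set.Ioi 0 → Integrable (fun t => f t * φ t) := by
    intro f hf φ h1 h2 h3
    have h4 : IntegrableOn (fun t => f t * φ t) (tsupport φ) :=
      (hf.integrableOn_compact_subset h3 h2).mul_continuousOn h1.continuousOn h2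
    rwa [integrableOn_iff_integrable_of_support_subset] at h4
    exact (Function.support_mul_subset_right _ _).trans subset_closure
  set f : ℝ → ℝ := fun t => g t - Γ t with hf
  have hfl : LocallyIntegrableOn f (Set.Ioi 0) := hg.sub hΓl
  have hfη : ∀ η : ℝ → ℝ, ContDiff ℝ ∞ η → HasCompactSupport η → tsupport η ⊆ Set.Ioi 0 →
      ∫ t, f t * deriv η t = 0 := by
    intro η h1 h2 h3
    have hc : Continuous (deriv η) := h1.continuous_deriv (by simp)
    have h3' : tsupport (deriv η) ⊆ Set.Ioi 0 := tsupport_deriv_subset.trans h3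
    simp only [hf, sub_mul]
    rw [integral_sub (hmul g hg _ hc h2.deriv h3') (hmul Γ hΓl _ hc h2.deriv h3'), h η h1 h2 h3,
      integral_primitive_mul_deriv hγ h1 h2 h3, sub_self]
  -- A unit-mass bump supported in `[1, 3]`. Subtracting the multiple `m θ` from a test function `φ`
  -- of mass `m` leaves a function of zero mean, hence the derivative of an admissible `η`; this
  -- forces `f` to equal `∫ f θ` almost everywhere.
  let b : ContDiffBump (2 : ℝ) := ⟨1 / 2, 1, by norm_num, by norm_num⟩
  set θ : ℝ → ℝ := b.normed volume with hθ
  have hθ1 : ContDiff ℝ ∞ θ := b.contDiff_normed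
  have hθ2 : HasCompactSupport θ := b.hasCompactSupport_normed
  have hθ3 : tsupport θ ⊆ Set.Ioi 0 := by
    rw [hθ, b.tsupport_normed_eq]
    intro t ht
    have : |t - 2| ≤ 1 := by simpa [Real.dist_eq, b] using ht
    have := neg_le_of_abs_le this
    show 0 < t
    linarith
  have hθ4 : ∫ t, θ t = 1 := b.integral_normed
  refine ⟨∫ t, f t * θ t, ?_⟩
  set C := ∫ t, f t * θ t with hC
  have key := isOpen_Ioi.ae_eq_zero_of_integral_contDiff_smul_eq_zero
    (hfl.sub (continuousOn_const (c := C) |>.locallyIntegrableOn measurableSet_Ioi)) fun φ h1 h2 h3 => by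
      set m := ∫ t, φ t with hm
      have hχ2 : HasCompactSupport (fun t => φ t - m * θ t) := h2.sub (hθ2.mul_left)
      have hχ3 : tsupport (fun t => φ t - m * θ t) ⊆ Set.Ioi 0 :=
        (tsupport_sub φ _).trans (Set.union_subset h3 ((tsupport_mul_subset_right).trans hθ3))
      have hχ4 : ∫ t, (φ t - m * θ t) = 0 := by
        rw [integral_sub (h1.continuous.integrable_of_hasCompactSupport h2)
          ((hθ1.continuous.integrable_of_hasCompactSupport hθ2).const_mul m), integral_const_mul, hθ4]
        simp [hm]
      obtain ⟨η, e1, e2, e3, e4⟩ := exists_contDiff_primitive (h1.sub (contDiff_const.mul hθ1)) hχ2 hχ3 hχ4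
      have := hfη η e1 e2 e3
      rw [e4] at this
      have i1 := hmul f hfl φ h1.continuous h2 h3
      have i2 := hmul f hfl θ hθ1.continuous hθ2 hθ3
      have e5 : ∫ t, f t * (φ t - m * θ t) = (∫ t, f t * φ t) - m * C := by
        rw [hC, ← integral_const_mul, ← integral_sub i1 (i2.const_mul m)]
        congr 1; ext t; ring
      have e6 : ∫ t, φ t • (f t - C) = (∫ t, f t * φ t) - C * m := by
        rw [hm, ← integral_const_mul, ← integral_sub i1
          ((h1.continuous.integrable_of_hasCompactSupport h2).const_mul C)]
        congr 1; ext t; simp only [smul_eq_mul]; ring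
      simp only [Pi.sub_apply]
      rw [e6]
      rw [e5] at this
      linarith
  filter_upwards [key] with t ht htm
  have := ht htm
  simp only [Pi.sub_apply, hf] at this
  linarith

/-! ### Polar coordinates -/

section Polar

/-- Surface measure on the unit sphere of `ℝ³`. -/
noncomputable abbrev sphereMeasure : Measure (Metric.sphere (0 : R3) 1) :=
  (volume : Measure R3).toSphere

theorem finrank_R3_sub_one : Module.finrank ℝ R3 - 1 = 2 := by simp

theorem lintegral_volumeIoiPow {f : ℝ → ℝ≥0∞} (hf : Measurable f) :
    ∫⁻ r : Set.Ioi (0 : ℝ), f r ∂Measure.volumeIoiPow 2 =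
      ∫⁻ r in Set.Ioi 0, ENNReal.ofReal (r ^ 2) * f r := by
  rw [Measure.volumeIoiPow, lintegral_withDensity_eq_lintegral_mul _ (by fun_prop) (by fun_prop)]
  exact lintegral_subtype_comap measurableSet_Ioi fun r => ENNReal.ofReal (r ^ 2) * f r

theorem lintegral_polar {F : R3 → ℝ≥0∞} (hF : Measurable F) :
    ∫⁻ x, F x = ∫⁻ r in Set.Ioi (0 : ℝ), ENNReal.ofReal (r ^ 2) *
      ∫⁻ w, F (r • (w : R3)) ∂sphereMeasure := by
  have hmp := (volume : Measure R3).measurePreserving_homeomorphUnitSphereProd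
  rw [finrank_R3_sub_one] at hmp
  have h1 := hmp.lintegral_comp_emb (Homeomorph.measurableEmbedding _)
    (fun p => F ((homeomorphUnitSphereProd R3).symm p))
  simp only [Homeomorph.symm_apply_apply, homeomorphUnitSphereProd_symm_apply_coe] at h1
  rw [lintegral_subtype_comap (measurableSet_singleton (0 : R3)).compl F, restrict_compl_singleton,
    lintegral_prod_symm' _ (by fun_prop)] at h1
  rw [h1]
  exact lintegral_volumeIoiPow (f := fun r => ∫⁻ w, F (r • (w : R3)) ∂sphereMeasure)
    (Measurable.lintegral_prod_right' (f := fun p : ℝ × Metric.sphere (0 : R3) 1 => F (p.1 • (p.2 : R3)))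
      (by fun_prop))

theorem lintegral_fun_norm {f : ℝ → ℝ≥0∞} (hf : Measurable f) :
    ∫⁻ x : R3, f ‖x‖ = sphereMeasure Set.univ *
      ∫⁻ r in Set.Ioi (0 : ℝ), ENNReal.ofReal (r ^ 2) * f r := by
  rw [lintegral_polar (by fun_prop), ← lintegral_const_mul _ (by fun_prop)]
  refine setLIntegral_congr_fun measurableSet_Ioi fun r hr => ?_
  have : ∀ w : Metric.sphere (0 : R3) 1, ‖r • (w : R3)‖ = r := fun w => by
    rw [norm_smul, norm_eq_of_mem_sphere w, mul_one, Real.norm_of_nonneg (le_of_lt hr)]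
  simp only [this, lintegral_const]
  ring

/-- A null set of radii has a null preimage under the norm, by the polar formula applied to the
indicator of a measurable null superset. -/
theorem ae_norm_of_ae_Ioi {p : ℝ → Prop} (h : ∀ᵐ t, t ∈ Set.Ioi (0 : ℝ) → p t) :
    ∀ᵐ x : R3, p ‖x‖ := by
  rw [← ae_restrict_iff' measurableSet_Ioi] at h
  obtain ⟨N, hN, hNm, hN0⟩ := exists_measurable_superset_of_null h
  have h1 := lintegral_fun_norm (f := N.indicator 1) (measurable_one.indicator hNm)
  have h2 : ∫⁻ r in Set.Ioi (0 : ℝ), ENNReal.ofReal (r ^ 2) * N.indicator 1 r = 0 := by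
    rw [lintegral_eq_zero_iff (by fun_prop (disch := assumption))]
    have : ∀ᵐ r ∂volume.restrict (Set.Ioi (0:ℝ)), r ∉ N := measure_eq_zero_iff_ae_notMem.1 hN0
    filter_upwards [this] with r hr
    simp [hr]
  rw [h2, mul_zero, lintegral_eq_zero_iff (f := fun x : R3 => N.indicator (1 : ℝ → ℝ≥0∞) ‖x‖)
    ((measurable_one.indicator hNm).comp measurable_norm)] at h1
  filter_upwards [h1] with x hx
  by_contra hc
  have : ‖x‖ ∈ N := hN hc
  simp [this] at hx

theorem integral_polar {F : R3 → ℝ} (hF : Integrable F) :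
    ∫ x, F x = ∫ r in Set.Ioi (0 : ℝ), r ^ 2 * ∫ w, F (r • (w : R3)) ∂sphereMeasure := by
  have hmp := (volume : Measure R3).measurePreserving_homeomorphUnitSphereProd
  rw [finrank_R3_sub_one] at hmp
  have hemb := (homeomorphUnitSphereProd R3).measurableEmbedding
  have hint : Integrable (fun p => F ((homeomorphUnitSphereProd R3).symm p))
      (sphereMeasure.prod (Measure.volumeIoiPow 2)) := by
    rw [← hmp.integrable_comp_emb hemb]
    have : Integrable F (volume.restrict {0}ᶜ) := hF.integrableOn
    rw [← IntegrableOn, integrableOn_iff_comap_subtypeVal (measurableSet_singleton _).compl] at this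
    convert this using 1
    ext x
    simp only [Function.comp_apply, Homeomorph.symm_apply_apply]
  have h1 := hmp.integral_comp hemb (fun p => F ((homeomorphUnitSphereProd R3).symm p))
  simp only [Homeomorph.symm_apply_apply] at h1
  rw [integral_subtype_comap (measurableSet_singleton (0 : R3)).compl F, restrict_compl_singleton,
    integral_prod_symm _ hint] at h1
  rw [h1]
  simp only [homeomorphUnitSphereProd_symm_apply_coe, Measure.volumeIoiPow, ENNReal.ofReal]
  rw [integral_withDensity_eq_integral_smul (measurable_subtype_coe.pow_const _).real_toNNReal,
    integral_subtype_comap measurableSet_Ioi fun r : ℝ =>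
      Real.toNNReal (r ^ 2) • ∫ w, F (r • (w : R3)) ∂sphereMeasure]
  refine setIntegral_congr_fun measurableSet_Ioi fun r hr => ?_
  simp only [NNReal.smul_def, Real.coe_toNNReal _ (sq_nonneg r), smul_eq_mul]

end Polar

/-! ### Radial test fields -/

section RadialField

variable {η : ℝ → ℝ}

/-- The components of the radial field `η(|x|) |x|⁻³ x`. -/
noncomputable def radialField (η : ℝ → ℝ) (i : Fin 3) (x : R3) : ℝ := η ‖x‖ / ‖x‖ ^ 3 * x i

/-- The only doubtful point is the origin, near which the field vanishes because the support of `η`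
avoids `0`. -/
theorem contDiff_radialField (h1 : ContDiff ℝ ∞ η) (h3 : tsupport η ⊆ Set.Ioi 0) (i : Fin 3) :
    ContDiff ℝ ∞ (radialField η i) := by
  rw [contDiff_iff_contDiffAt]
  intro x
  rcases eq_or_ne x 0 with rfl | hx
  · have h0 : (0 : ℝ) ∉ tsupport η := fun h => lt_irrefl (0 : ℝ) (h3 h)
    have h0' : ∀ᶠ x : R3 in 𝓝 0, η ‖x‖ = 0 :=
      (continuous_norm.tendsto' (0 : R3) 0 norm_zero).eventually (notMem_tsupport_iff_eventuallyEq.1 h0)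
    refine (contDiffAt_const (c := (0 : ℝ))).congr_of_eventuallyEq ?_
    filter_upwards [h0'] with y hy
    simp [radialField, hy]
  · have hn : ContDiffAt ℝ ∞ (fun y : R3 => ‖y‖) x := contDiffAt_norm ℝ hx
    exact ((h1.contDiffAt.comp x hn).div (hn.pow 3) (by simpa using hx)).mul
      (EuclideanSpace.proj (𝕜 := ℝ) i).contDiff.contDiffAt

theorem hasCompactSupport_radialField (h2 : HasCompactSupport η) (i : Fin 3) :
    HasCompactSupport (radialField η i) := by
  obtain ⟨R, hR⟩ := h2.isBounded.subset_closedBall 0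
  refine HasCompactSupport.of_support_subset_isCompact (isCompact_closedBall (0 : R3) R) fun x hx => ?_
  have : η ‖x‖ ≠ 0 := fun h => hx (by simp [radialField, h])
  simpa using hR (subset_tsupport _ this)

/-- In dimension three `div (ψ(|x|) x) = |x| ψ' + 3 ψ`. With `ψ = η / r³` the terms in `η` cancel,
and the remaining `r⁻²` is exactly compensated by the polar Jacobian. -/
theorem sum_fderiv_radialField (h1 : ContDiff ℝ ∞ η) {x : R3} (hx : x ≠ 0) :
    ∑ i, fderiv ℝ (radialField η i) x (EuclideanSpace.single i 1) = deriv η ‖x‖ / ‖x‖ ^ 2 := by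
  have hr : 0 < ‖x‖ := norm_pos_iff.2 hx
  have hn : HasFDerivAt (fun y : R3 => ‖y‖) (‖x‖⁻¹ • innerSL ℝ x) x := by
    have h := (hasStrictFDerivAt_norm_sq x).hasFDerivAt.sqrt (by positivity)
    simp only [Real.sqrt_sq (norm_nonneg _)] at h
    refine h.congr_fderiv ?_
    rw [← Nat.cast_smul_eq_nsmul ℝ, smul_smul]
    congr 1
    field_simp
    norm_num
  have hζ : HasDerivAt (fun r => η r / r ^ 3)
      ((deriv η ‖x‖ * ‖x‖ ^ 3 - η ‖x‖ * (3 * ‖x‖ ^ 2)) / (‖x‖ ^ 3) ^ 2) ‖x‖ :=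
    ((h1.differentiable (by simp) ‖x‖).hasDerivAt).fun_div (by simpa using hasDerivAt_pow 3 ‖x‖) (by positivity)
  have hΨ := hζ.comp_hasFDerivAt x hn
  have hφ : ∀ i, fderiv ℝ (radialField η i) x (EuclideanSpace.single i 1) =
      η ‖x‖ / ‖x‖ ^ 3 + x i ^ 2 * (((deriv η ‖x‖ * ‖x‖ ^ 3 - η ‖x‖ * (3 * ‖x‖ ^ 2)) / (‖x‖ ^ 3) ^ 2) * ‖x‖⁻¹) := by
    intro i
    have := (hΨ.mul ((EuclideanSpace.proj (𝕜 := ℝ) i).hasFDerivAt (x := x))).fderiv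
    rw [show radialField η i = ((fun r => η r / r ^ 3) ∘ fun y : R3 => ‖y‖) *
      (EuclideanSpace.proj (𝕜 := ℝ) i : R3 → ℝ) from rfl, this]
    simp [EuclideanSpace.inner_single_right]
    ring
  simp only [hφ, Finset.sum_add_distrib, ← Finset.sum_mul, ← EuclideanSpace.real_norm_sq_eq]
  simp
  field_simp
  ring

end RadialField

/-! ### From weak gradients to radial profiles -/

theorem lintegral_enorm_sq_eq {α E : Type*} [MeasurableSpace α] [NormedAddCommGroup E] (f : α → E)
    (μ : Measure α) : ∫⁻ x, ‖f x‖ₑ ^ 2 ∂μ = eLpNorm f 2 μ ^ 2 := by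
  have := eLpNorm_nnreal_pow_eq_lintegral (f := f) (μ := μ) (p := 2) (by simp)
  simpa using this.symm

/-- The polar Jacobian `r²` is bounded away from zero on compact subsets of `(0, ∞)`, so it can be
divided out. -/
theorem locallyIntegrableOn_profile {u : R3 → ℝ} {g : ℝ → ℝ} (hu : LocallyIntegrable u)
    (hg : u =ᵐ[volume] fun x => g ‖x‖) : LocallyIntegrableOn g (Set.Ioi 0) := by
  rw [locallyIntegrableOn_iff isOpen_Ioi.isLocallyClosed]
  intro K hK hKc
  obtain ⟨s, R, hs, hs1, hR, hKs⟩ := exists_subset_Ioo_of_isCompact hKc hK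
  have h1 : IntegrableOn u (Metric.ball 0 R) :=
    (hu.integrableOn_isCompact (isCompact_closedBall 0 R)).mono_set Metric.ball_subset_closedBall
  have h2 : IntegrableOn (fun x : R3 => g ‖x‖) (Metric.ball 0 R) :=
    h1.congr (ae_restrict_of_ae hg)
  rw [integrableOn_fun_norm_addHaar, finrank_R3_sub_one] at h2
  have h3 := (h2.mono_set (hKs.trans (Set.Ioo_subset_Ioo_left hs.le))).continuousOn_mul
    (g := fun y : ℝ => (y ^ 2)⁻¹)
    ((continuousOn_id.pow 2).inv₀ fun y hy => pow_ne_zero 2 (ne_of_gt (hK hy))) hKc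
  refine h3.congr_fun (fun y hy => ?_) hKc.measurableSet
  have : (0 : ℝ) < y := hK hy
  simp only [smul_eq_mul]
  field_simp

/-- The radial component of a vector field, averaged over spheres. -/
noncomputable def radialAverage (G : R3 → R3) (r : ℝ) : ℝ :=
  (sphereMeasure.real Set.univ)⁻¹ * ∫ w, inner ℝ (w : R3) (G (r • (w : R3))) ∂sphereMeasure

theorem sphereMeasure_real_pos : 0 < sphereMeasure.real Set.univ := by
  rw [measureReal_def]
  exact ENNReal.toReal_pos (by simp [Real.pi_pos]) (measure_ne_top _ _)

theorem measurable_radialAverage {G : R3 → R3} (hG : StronglyMeasurable G) :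
    Measurable (radialAverage G) := by
  have hm := hG.measurable
  have : StronglyMeasurable fun p : ℝ × Metric.sphere (0 : R3) 1 =>
      inner ℝ (p.2 : R3) (G (p.1 • (p.2 : R3))) :=
    Measurable.stronglyMeasurable (by fun_prop)
  exact (this.integral_prod_right' (ν := sphereMeasure)).measurable.const_mul _

/-- Cauchy–Schwarz on each sphere bounds the square of the average by the spherical mean of `|G|²`;
integrating against `r² dr` recovers `‖G‖₂²`. The factor in front of `D` is the inverse square root
of the area of the sphere. -/
theorem radialEnergyLE_radialAverage {G : R3 → R3} (hG : StronglyMeasurable G) {D : ℝ≥0}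
    (hD : eLpNorm G 2 volume ≤ D) :
    RadialEnergyLE (radialAverage G) (NNReal.sqrt (sphereMeasure.real Set.univ)⁻¹.toNNReal * D) := by
  refine ⟨measurable_radialAverage hG, ?_⟩
  have hm := hG.measurable
  set c := sphereMeasure.real Set.univ with hc
  have hc0 : 0 < c := sphereMeasure_real_pos
  have hcu : sphereMeasure Set.univ = ENNReal.ofReal c := by simp [hc, measureReal_def]
  have hcc : ENNReal.ofReal c⁻¹ * ENNReal.ofReal c = 1 := by
    rw [← ENNReal.ofReal_mul (by positivity), inv_mul_cancel₀ hc0.ne', ENNReal.ofReal_one]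
  have hpt : ∀ r ∈ Set.Ioi (0 : ℝ), (ENNReal.ofReal r * ‖radialAverage G r‖ₑ) ^ 2 ≤
      ENNReal.ofReal c⁻¹ * (ENNReal.ofReal (r ^ 2) *
        ∫⁻ w, ‖G (r • (w : R3))‖ₑ ^ 2 ∂sphereMeasure) := by
    intro r hr
    have hr0 : 0 < r := hr
    have h1 : ‖radialAverage G r‖ₑ ≤
        ENNReal.ofReal c⁻¹ * ∫⁻ w, ‖G (r • (w : R3))‖ₑ * 1 ∂sphereMeasure := by
      rw [radialAverage, enorm_mul, Real.enorm_of_nonneg (by positivity)]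
      gcongr
      refine (enorm_integral_le_lintegral_enorm _).trans (lintegral_mono fun w => ?_)
      rw [mul_one, ← ofReal_norm, ← ofReal_norm]
      refine ENNReal.ofReal_le_ofReal ((norm_inner_le_norm _ _).trans_eq ?_)
      rw [norm_eq_of_mem_sphere w, one_mul]
    have h2 := lintegral_mul_sq_le (μ := sphereMeasure) (f := fun w => ‖G (r • (w : R3))‖ₑ)
      (g := fun _ => 1) (by fun_prop) (by fun_prop)
    simp only [one_pow, lintegral_one, hcu] at h2
    calc _ ≤ (ENNReal.ofReal r * (ENNReal.ofReal c⁻¹ * ∫⁻ w, ‖G (r • (w : R3))‖ₑ * 1 ∂sphereMeasure)) ^ 2 := by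
          gcongr
      _ = ENNReal.ofReal r ^ 2 * ENNReal.ofReal c⁻¹ ^ 2 * (∫⁻ w, ‖G (r • (w : R3))‖ₑ * 1 ∂sphereMeasure) ^ 2 := by
          ring
      _ ≤ ENNReal.ofReal r ^ 2 * ENNReal.ofReal c⁻¹ ^ 2 *
          ((∫⁻ w, ‖G (r • (w : R3))‖ₑ ^ 2 ∂sphereMeasure) * ENNReal.ofReal c) := by gcongr
      _ = (ENNReal.ofReal c⁻¹ * ENNReal.ofReal c) * (ENNReal.ofReal c⁻¹ * (ENNReal.ofReal r ^ 2 *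
          ∫⁻ w, ‖G (r • (w : R3))‖ₑ ^ 2 ∂sphereMeasure)) := by ring
      _ = _ := by rw [hcc, one_mul, ENNReal.ofReal_pow hr0.le]
  calc _ ≤ ∫⁻ r in Set.Ioi (0 : ℝ), ENNReal.ofReal c⁻¹ * (ENNReal.ofReal (r ^ 2) *
        ∫⁻ w, ‖G (r • (w : R3))‖ₑ ^ 2 ∂sphereMeasure) := setLIntegral_mono' measurableSet_Ioi hpt
    _ = ENNReal.ofReal c⁻¹ * eLpNorm G 2 volume ^ 2 := by
        rw [lintegral_const_mul' _ _ (by simp), ← lintegral_polar (F := fun x => ‖G x‖ₑ ^ 2) (by fun_prop),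
          lintegral_enorm_sq_eq]
    _ ≤ ENNReal.ofReal c⁻¹ * (D : ℝ≥0∞) ^ 2 := by gcongr
    _ = _ := by
        rw [ENNReal.ofReal, ← ENNReal.coe_pow, ← ENNReal.coe_pow, ← ENNReal.coe_mul, mul_pow, NNReal.sq_sqrt]

/-- Test the weak gradient against the field `η(|x|) |x|⁻³ x` and sum over coordinates. In polar
coordinates both sides become one-dimensional integrals times the area of the sphere. Thus the
radial average of `G` is the weak derivative of the profile. -/
theorem integral_profile_mul_deriv {u : R3 → ℝ} {G : R3 → R3} (h : HasWeakGradient u G) {g : ℝ → ℝ}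
    (hg : u =ᵐ[volume] fun x => g ‖x‖) {η : ℝ → ℝ} (h1 : ContDiff ℝ ∞ η) (h2 : HasCompactSupport η)
    (h3 : tsupport η ⊆ Set.Ioi 0) :
    ∫ t, g t * deriv η t = -∫ t, radialAverage G t * η t := by
  set c := sphereMeasure.real Set.univ with hc
  have hc0 : 0 < c := sphereMeasure_real_pos
  have hη0 : ∀ t, t ∉ Set.Ioi (0 : ℝ) → η t = 0 := fun t ht =>
    image_eq_zero_of_notMem_tsupport fun h => ht (h3 h)
  have hη1 : ∀ t, t ∉ Set.Ioi (0 : ℝ) → deriv η t = 0 := fun t ht =>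
    image_eq_zero_of_notMem_tsupport fun h => ht (h3 (tsupport_deriv_subset h))
  have hI : ∀ f : ℝ → ℝ, (∀ t, t ∉ Set.Ioi (0 : ℝ) → f t = 0) → ∫ t, f t = ∫ t in Set.Ioi 0, f t :=
    fun f hf => (setIntegral_eq_integral_of_forall_compl_eq_zero hf).symm
  have hsm : ∀ i, ContDiff ℝ ∞ (radialField η i) := contDiff_radialField h1 h3
  have hcs : ∀ i, HasCompactSupport (radialField η i) := hasCompactSupport_radialField h2
  have hl : ∑ i, ∫ x, u x * fderiv ℝ (radialField η i) x (EuclideanSpace.single i 1) =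
      c * ∫ t, g t * deriv η t := by
    rw [← integral_finsetSum]
    · have : ∀ᵐ x : R3, ∑ i, u x * fderiv ℝ (radialField η i) x (EuclideanSpace.single i 1) =
          (fun r => g r * (deriv η r / r ^ 2)) ‖x‖ := by
        filter_upwards [hg, compl_mem_ae_iff.2 (measure_singleton (0 : R3))] with x hx hx0
        rw [← Finset.mul_sum, sum_fderiv_radialField h1 hx0, hx]
      rw [integral_congr_ae this, integral_fun_norm_addHaar volume (fun r => g r * (deriv η r / r ^ 2)),
        hI _ fun t ht => by rw [hη1 t ht, mul_zero], hc, Measure.toSphere_real_apply_univ, finrank_R3_sub_one,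
        nsmul_eq_mul, smul_eq_mul, ← mul_assoc]
      congr 1
      refine setIntegral_congr_fun measurableSet_Ioi fun r hr => ?_
      have hr0 : (0 : ℝ) < r := hr
      simp only [smul_eq_mul]
      field_simp
    · intro i _
      exact h.1.integrable_smul_right_of_hasCompactSupport
        (((hsm i).continuous_fderiv (by simp)).clm_apply continuous_const) ((hcs i).fderiv_apply ℝ _)
  have hint : ∀ i, Integrable (fun x => G x i * radialField η i x) := fun i => by
    have := h.2.1.integrable_smul_left_of_hasCompactSupport (hsm i).continuous (hcs i)
    refine ((EuclideanSpace.proj (𝕜 := ℝ) i).integrable_comp this).congr (.of_forall fun x => ?_)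
    simp [mul_comm]
  have hr : ∑ i, ∫ x, G x i * radialField η i x = c * ∫ t, radialAverage G t * η t := by
    rw [← integral_finsetSum _ fun i _ => hint i, integral_polar (integrable_finsetSum _ fun i _ => hint i),
      hI _ fun t ht => by rw [hη0 t ht, mul_zero], ← integral_const_mul]
    refine setIntegral_congr_fun measurableSet_Ioi fun r hr => ?_
    have hr0 : (0 : ℝ) < r := hr
    have e1 : ∀ w : Metric.sphere (0 : R3) 1,
        ∑ i, G (r • (w : R3)) i * radialField η i (r • (w : R3)) =
          η r / r ^ 2 * inner ℝ (w : R3) (G (r • (w : R3))) := fun w => by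
      rw [PiLp.inner_apply, Finset.mul_sum]
      refine Finset.sum_congr rfl fun i _ => ?_
      have : ‖r • (w : R3)‖ = r := by
        rw [norm_smul, norm_eq_of_mem_sphere w, mul_one, Real.norm_of_nonneg hr0.le]
      rw [radialField, this]
      simp
      field_simp
    simp only [e1, integral_const_mul, radialAverage, ← hc]
    field_simp
  have key : ∑ i, ∫ x, u x * fderiv ℝ (radialField η i) x (EuclideanSpace.single i 1) =
      -∑ i, ∫ x, G x i * radialField η i x := by
    rw [← Finset.sum_neg_distrib]
    exact Finset.sum_congr rfl fun i _ => h.2.2 _ (hsm i) (hcs i) i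
  rw [hl, hr, ← mul_neg] at key
  exact mul_left_cancel₀ hc0.ne' key

/-- A radial function with weak gradient in `L²` has an absolutely continuous profile. -/
theorem exists_radialProfile : ∃ κ : ℝ≥0, ∀ (u : R3 → ℝ) (G : R3 → R3) (D : ℝ≥0), IsRadial u →
    HasWeakGradient u G → eLpNorm G 2 volume ≤ D →
      ∃ g γ, RadialProfile g γ (κ * D) ∧ u =ᵐ[volume] fun x => g ‖x‖ := by
  refine ⟨NNReal.sqrt (sphereMeasure.real Set.univ)⁻¹.toNNReal, fun u G D hu h hD => ?_⟩
  obtain ⟨g, hg⟩ := hu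
  -- Spherical averages need a genuinely measurable field, so `G` is replaced by a strongly
  -- measurable representative.
  have hGm := h.2.1.aestronglyMeasurable
  have hGe : G =ᵐ[volume] hGm.mk := hGm.ae_eq_mk
  have h' : HasWeakGradient u hGm.mk := by
    refine ⟨h.1, h.2.1.congr hGe, fun φ h1 h2 i => ?_⟩
    rw [h.2.2 φ h1 h2 i]
    congr 1
    refine integral_congr_ae ?_
    filter_upwards [hGe] with x hx
    rw [hx]
  have hE := radialEnergyLE_radialAverage hGm.stronglyMeasurable_mk ((eLpNorm_congr_ae hGe.symm).trans_le hD)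
  have hi : ∀ s r, 0 < s → s ≤ r → IntervalIntegrable (radialAverage hGm.mk) volume s r :=
    fun s r hs hr => hE.intervalIntegrable hs hr
  obtain ⟨C, hC⟩ := ae_eq_const_add_primitive (locallyIntegrableOn_profile h.1 hg) hi
    fun η h1 h2 h3 => integral_profile_mul_deriv h' hg h1 h2 h3
  refine ⟨fun t => C + ∫ v in (1 : ℝ)..t, radialAverage hGm.mk v, radialAverage hGm.mk,
    ⟨hE, fun s r hs hr => ?_⟩, ?_⟩
  · have h1r : IntervalIntegrable (radialAverage hGm.mk) volume 1 r := by
      rcases le_total 1 r with h | h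
      · exact hi 1 r one_pos h
      · exact (hi r 1 (hs.trans_le hr) h).symm
    have h1s : IntervalIntegrable (radialAverage hGm.mk) volume 1 s := by
      rcases le_total 1 s with h | h
      · exact hi 1 s one_pos h
      · exact (hi s 1 hs h).symm
    rw [add_sub_add_left_eq_sub, intervalIntegral.integral_interval_sub_left h1r h1s]
  · filter_upwards [hg, ae_norm_of_ae_Ioi hC] with x hx hx'
    rw [hx, hx']

/-! ### Lower bounds for the Bopp–Podolsky energy -/

section Energy

variable {a : ℝ}

/-- This is `e^{-t} ≤ 1/(1 + t)` at `t = ‖z‖ / a`. -/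
theorem inv_add_norm_le_bpKernel (ha : 0 < a) {z : R3} (hz : z ≠ 0) :
    (a + ‖z‖)⁻¹ ≤ bpKernel a z := by
  have hz0 : 0 < ‖z‖ := norm_pos_iff.2 hz
  have h1 : Real.exp (-‖z‖ / a) ≤ a / (a + ‖z‖) := by
    have h2 : (a + ‖z‖) / a ≤ Real.exp (‖z‖ / a) := by
      have := Real.add_one_le_exp (‖z‖ / a)
      rwa [add_div, div_self ha.ne', add_comm]
    rw [neg_div, Real.exp_neg, ← inv_div (a + ‖z‖) a]
    exact inv_anti₀ (by positivity) h2
  rw [bpKernel, le_div_iff₀ hz0]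
  have h3 : (a + ‖z‖)⁻¹ * ‖z‖ = 1 - a / (a + ‖z‖) := by field_simp; ring
  linarith

/-- For `x`, `y` in the ball, `|x - y| ≤ 2R`, so the kernel is at least `(a + 2R)⁻¹` and the double
integral factors. -/
theorem sq_lintegral_le_bpEnergySq (ha : 0 < a) {u : R3 → ℝ} (hu : AEMeasurable u) {R : ℝ} (hR : 0 ≤ R) :
    (∫⁻ x in Metric.closedBall 0 R, ENNReal.ofReal (u x ^ 2)) ^ 2 ≤
      ENNReal.ofReal (a + 2 * R) * bpEnergySq a u := by
  set f : R3 → ℝ≥0∞ := fun x => ENNReal.ofReal (u x ^ 2) with hf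
  have hfm : AEMeasurable f := (hu.pow_const 2).ennreal_ofReal
  set B : Set R3 := Metric.closedBall 0 R
  set I := ∫⁻ x in B, f x with hI
  set k := ENNReal.ofReal (a + 2 * R)⁻¹ with hk
  have hB : MeasurableSet B := Metric.isClosed_closedBall.measurableSet
  have hkk : ENNReal.ofReal (a + 2 * R) * k = 1 := by
    rw [hk, ← ENNReal.ofReal_mul (by positivity), mul_inv_cancel₀ (by positivity), ENNReal.ofReal_one]
  have h1 : k * I * I ≤ bpEnergySq a u := by
    calc k * I * I = ∫⁻ x in B, k * I * f x := (lintegral_const_mul'' _ hfm.restrict).symm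
      _ = ∫⁻ x in B, ∫⁻ y in B, k * f x * f y := by
          refine lintegral_congr fun x => ?_
          rw [lintegral_const_mul' _ _ (ENNReal.mul_ne_top (by simp [hk]) (by simp [hf]))]
          ring
      _ ≤ ∫⁻ x in B, ∫⁻ y in B, ENNReal.ofReal (bpKernel a (x - y)) * f x * f y := by
          refine setLIntegral_mono' hB fun x hx => ?_
          -- The diagonal must be discarded: division by zero makes `bpKernel a 0 = 0`, which
          -- violates the lower bound.
          refine lintegral_mono_ae ?_
          filter_upwards [ae_restrict_mem hB,
            ae_restrict_of_ae (compl_mem_ae_iff.2 (measure_singleton x))] with y hy hyx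
          gcongr
          have hxy : x - y ≠ 0 := sub_ne_zero.2 fun h => hyx h.symm
          refine ENNReal.ofReal_le_ofReal ?_
          refine (inv_anti₀ (by positivity) ?_).trans (inv_add_norm_le_bpKernel ha hxy)
          have h1 : ‖x‖ ≤ R := by simpa [B] using hx
          have h2 : ‖y‖ ≤ R := by simpa [B] using hy
          linarith [norm_sub_le x y]
      _ ≤ ∫⁻ x in B, ∫⁻ y, ENNReal.ofReal (bpKernel a (x - y)) * f x * f y :=
          lintegral_mono fun x => setLIntegral_le_lintegral _ _
      _ ≤ _ := setLIntegral_le_lintegral _ _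
  calc I ^ 2 = (ENNReal.ofReal (a + 2 * R) * k) * I ^ 2 := by rw [hkk, one_mul]
    _ = ENNReal.ofReal (a + 2 * R) * (k * I * I) := by ring
    _ ≤ _ := by gcongr

/-- On the shell `2^k ≤ |x| < 2^{k+1}` the mass of `u²` is at most `√((a + 4) 2^k) V^{1/2}`, while
the weight is at most `2^{-k/2 - kε}`. The products form a geometric series of ratio `2^{-ε}`. -/
theorem exists_lintegral_weight_le (ha : 0 < a) {ε : ℝ} (hε : 0 < ε) :
    ∃ C : ℝ≥0, ∀ u : R3 → ℝ, AEMeasurable u →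
      ∫⁻ x in {x : R3 | 1 ≤ ‖x‖}, ENNReal.ofReal (u x ^ 2 * ‖x‖ ^ (-(1 / 2) - ε)) ≤
        C * bpEnergySq a u ^ (1 / 2 : ℝ) := by
  set q : ℝ := 2 ^ (-ε) with hq
  have hq1 : q < 1 := Real.rpow_lt_one_of_one_lt_of_neg one_lt_two (by linarith)
  have hq0 : 0 < q := by positivity
  have hsum : Summable fun k : ℕ => √(a + 4) * q ^ k :=
    (summable_geometric_of_lt_one hq0.le hq1).mul_left _
  have hne : ∑' k : ℕ, ENNReal.ofReal (√(a + 4) * q ^ k) ≠ ⊤ := hsum.tsum_ofReal_ne_top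
  refine ⟨(∑' k : ℕ, ENNReal.ofReal (√(a + 4) * q ^ k)).toNNReal, fun u hu => ?_⟩
  rw [ENNReal.coe_toNNReal hne, ← ENNReal.tsum_mul_right]
  have hcov : {x : R3 | 1 ≤ ‖x‖} ⊆ ⋃ k : ℕ, {x : R3 | (2 : ℝ) ^ k ≤ ‖x‖ ∧ ‖x‖ < 2 ^ (k + 1)} := by
    intro x hx
    obtain ⟨n, hn⟩ := exists_nat_pow_near (x := ‖x‖) (y := 2) hx one_lt_two
    exact Set.mem_iUnion.2 ⟨n, hn⟩
  refine (lintegral_mono_set hcov).trans ((lintegral_iUnion_le _ _).trans (ENNReal.tsum_le_tsum fun k => ?_))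
  set A := {x : R3 | (2 : ℝ) ^ k ≤ ‖x‖ ∧ ‖x‖ < 2 ^ (k + 1)} with hA
  have hAm : MeasurableSet A :=
    (measurableSet_le measurable_const measurable_norm).inter (measurableSet_lt measurable_norm measurable_const)
  have hAB : A ⊆ Metric.closedBall 0 (2 ^ (k + 1)) := fun x hx => by simpa using hx.2.le
  have h2k : (0 : ℝ) < 2 ^ k := by positivity
  have h2k1 : (1 : ℝ) ≤ 2 ^ k := one_le_pow₀ one_le_two
  have hE := sq_lintegral_le_bpEnergySq ha hu (R := 2 ^ (k + 1)) (by positivity)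
  set I := ∫⁻ x in Metric.closedBall (0 : R3) (2 ^ (k + 1)), ENNReal.ofReal (u x ^ 2)
  have hE2 : I ≤ ENNReal.ofReal (√((a + 4) * 2 ^ k)) * bpEnergySq a u ^ (1 / 2 : ℝ) := by
    have h1 : I ^ 2 ≤ ENNReal.ofReal ((a + 4) * 2 ^ k) * bpEnergySq a u := by
      refine hE.trans ?_
      gcongr
      rw [pow_succ]
      nlinarith
    have h3 : I = (I ^ 2) ^ (1 / 2 : ℝ) := by
      rw [← ENNReal.rpow_natCast, ← ENNReal.rpow_mul]; norm_num
    calc I = (I ^ 2) ^ (1 / 2 : ℝ) := h3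
      _ ≤ (ENNReal.ofReal ((a + 4) * 2 ^ k) * bpEnergySq a u) ^ (1 / 2 : ℝ) := by gcongr
      _ = _ := by
        rw [ENNReal.mul_rpow_of_nonneg _ _ (by norm_num), ENNReal.ofReal_rpow_of_nonneg (by positivity)
          (by norm_num), Real.sqrt_eq_rpow]
  have hw : ∀ x ∈ A, ‖x‖ ^ (-(1 / 2) - ε) ≤ ((2 : ℝ) ^ k) ^ (-(1 / 2) - ε) := fun x hx =>
    Real.rpow_le_rpow_of_nonpos h2k hx.1 (by linarith)
  have hpow : ((2 : ℝ) ^ k) ^ (-(1 / 2) - ε) * √((a + 4) * 2 ^ k) = √(a + 4) * q ^ k := by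
    rw [Real.sqrt_mul (by positivity), Real.sqrt_eq_rpow (2 ^ k), hq, ← Real.rpow_natCast (2 ^ (-ε)),
      ← Real.rpow_mul (by norm_num), mul_comm (-ε), Real.rpow_mul (by norm_num), Real.rpow_natCast]
    calc _ = √(a + 4) * (((2 : ℝ) ^ k) ^ (-(1 / 2) - ε) * ((2 : ℝ) ^ k) ^ (1 / 2 : ℝ)) := by ring
      _ = _ := by rw [← Real.rpow_add h2k]; congr 2; ring
  calc _ ≤ ∫⁻ x in A, ENNReal.ofReal (((2 : ℝ) ^ k) ^ (-(1 / 2) - ε)) * ENNReal.ofReal (u x ^ 2) := by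
        refine setLIntegral_mono' hAm fun x hx => ?_
        rw [← ENNReal.ofReal_mul (by positivity), mul_comm (u x ^ 2)]
        exact ENNReal.ofReal_le_ofReal (mul_le_mul_of_nonneg_right (hw x hx) (sq_nonneg _))
    _ = ENNReal.ofReal (((2 : ℝ) ^ k) ^ (-(1 / 2) - ε)) * ∫⁻ x in A, ENNReal.ofReal (u x ^ 2) :=
        lintegral_const_mul' _ _ (by simp)
    _ ≤ ENNReal.ofReal (((2 : ℝ) ^ k) ^ (-(1 / 2) - ε)) *
        (ENNReal.ofReal (√((a + 4) * 2 ^ k)) * bpEnergySq a u ^ (1 / 2 : ℝ)) := by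
        gcongr
        exact (lintegral_mono_set hAB).trans hE2
    _ = _ := by rw [← mul_assoc, ← ENNReal.ofReal_mul (by positivity), hpow]

end Energy

/-- Setting the profile to zero off `(0, ∞)`, where it is unconstrained, makes it measurable on the
whole line, as the polar formulas require. -/
theorem RadialProfile.exists_measurable {g γ : ℝ → ℝ} {D : ℝ≥0} (h : RadialProfile g γ D) :
    ∃ g', Measurable g' ∧ RadialProfile g' γ D ∧ ∀ x : R3, x ≠ 0 → g' ‖x‖ = g ‖x‖ := by
  classical
  refine ⟨(Set.Ioi 0).piecewise g 0, h.continuousOn_Ioi.measurable_piecewise continuousOn_const measurableSet_Ioi,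
    ⟨h.toRadialEnergyLE, fun s r hs hr => ?_⟩, fun x hx => by simp [norm_pos_iff.2 hx]⟩
  rw [← h.ftc s r hs hr]
  simp [hs, hs.trans_le hr]

/-! ### Norms of a radial function in terms of its profile -/

section SphericalLp

theorem sphereMeasure_ne_zero : sphereMeasure Set.univ ≠ 0 := fun h =>
  sphereMeasure_real_pos.ne' (by simp only [measureReal_def, h, ENNReal.toReal_zero])

theorem lintegral_enorm_pow_six {u : R3 → ℝ} {g : ℝ → ℝ} (hgm : Measurable g)
    (hg : u =ᵐ[volume] fun x => g ‖x‖) :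
    ∫⁻ x, ‖u x‖ₑ ^ 6 = sphereMeasure Set.univ *
      ∫⁻ t in Set.Ioi 0, ENNReal.ofReal (g t ^ 6 * t ^ 2) := by
  calc ∫⁻ x, ‖u x‖ₑ ^ 6 = ∫⁻ x : R3, (fun t => ENNReal.ofReal (g t ^ 6)) ‖x‖ := by
        refine lintegral_congr_ae ?_
        filter_upwards [hg] with x hx
        rw [hx, Real.enorm_eq_ofReal_abs, ← ENNReal.ofReal_pow (abs_nonneg _), pow_abs,
          abs_of_nonneg (by positivity)]
    _ = _ := by
        rw [lintegral_fun_norm (f := fun t => ENNReal.ofReal (g t ^ 6)) (by fun_prop)]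
        congr 1
        refine lintegral_congr fun t => ?_
        rw [← ENNReal.ofReal_mul (by positivity), mul_comm]

theorem lintegral_enorm_pow_six_eq (u : R3 → ℝ) : ∫⁻ x, ‖u x‖ₑ ^ 6 = eLpNorm u 6 volume ^ 6 := by
  have := eLpNorm_nnreal_pow_eq_lintegral (f := u) (μ := volume) (p := 6) (by simp)
  have h6 : ∀ y : ℝ≥0∞, y ^ (6 : ℝ) = y ^ 6 := fun y => by exact_mod_cast ENNReal.rpow_natCast y 6
  simpa [h6] using this.symm

/-- The polar Jacobian `t²` raises the exponent `-1/2 - ε` to `3/2 - ε`. -/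
theorem lintegral_weight_profile {u : R3 → ℝ} {g : ℝ → ℝ} (hgm : Measurable g)
    (hg : u =ᵐ[volume] fun x => g ‖x‖) (ε : ℝ) :
    sphereMeasure Set.univ * ∫⁻ t in Set.Ioi 1, ENNReal.ofReal (g t ^ 2 * t ^ (3 / 2 - ε)) ≤
      ∫⁻ x in {x : R3 | 1 ≤ ‖x‖}, ENNReal.ofReal (u x ^ 2 * ‖x‖ ^ (-(1 / 2) - ε)) := by
  have hS : MeasurableSet {x : R3 | 1 ≤ ‖x‖} := measurableSet_le measurable_const measurable_norm
  set f : ℝ → ℝ≥0∞ := (Set.Ici 1).indicator fun t => ENNReal.ofReal (g t ^ 2 * t ^ (-(1 / 2) - ε)) with hf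
  have hfm : Measurable f := Measurable.indicator (by fun_prop) measurableSet_Ici
  have e1 : ∫⁻ x in {x : R3 | 1 ≤ ‖x‖}, ENNReal.ofReal (u x ^ 2 * ‖x‖ ^ (-(1 / 2) - ε)) =
      ∫⁻ x : R3, f ‖x‖ := by
    rw [← lintegral_indicator hS]
    refine lintegral_congr_ae ?_
    filter_upwards [hg] with x hx
    by_cases h : 1 ≤ ‖x‖ <;> simp [hf, h, hx]
  rw [e1, lintegral_fun_norm hfm]
  refine mul_le_mul' le_rfl ?_
  calc _ = ∫⁻ t in Set.Ioi 1, ENNReal.ofReal (t ^ 2) * f t := by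
        refine setLIntegral_congr_fun measurableSet_Ioi fun t ht => ?_
        have ht1 : (1 : ℝ) < t := ht
        have ht0 : 0 < t := by linarith
        have : f t = ENNReal.ofReal (g t ^ 2 * t ^ (-(1 / 2) - ε)) :=
          Set.indicator_of_mem (Set.mem_Ici.2 ht1.le) _
        rw [this, ← ENNReal.ofReal_mul (by positivity)]
        congr 1
        rw [mul_left_comm, ← Real.rpow_natCast t 2, ← Real.rpow_add ht0]
        congr 2
        push_cast
        ring
    _ ≤ _ := lintegral_mono_set (Set.Ioi_subset_Ioi zero_le_one)

end SphericalLp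

/-! ### A priori estimates in `L⁶` and at infinity -/

/-- The profile of a radial function of `D^{1,2}(ℝ³)`. -/
theorem exists_measurable_radialProfile : ∃ K : ℝ≥0, ∀ (u : R3 → ℝ) (G : R3 → R3) (N : ℝ≥0),
    IsRadial u → MemLp u 6 volume → HasWeakGradient u G → eLpNorm G 2 volume ≤ N →
      ∃ g γ, Measurable g ∧ RadialProfile g γ (K * N) ∧ (u =ᵐ[volume] fun x => g ‖x‖) ∧
        ∀ ε > 0, ∀ s, ∃ r, s ≤ r ∧ |g r| ≤ ε := by
  obtain ⟨K, hK⟩ := exists_radialProfile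
  refine ⟨K, fun u G N hu h6 hG hN => ?_⟩
  obtain ⟨g₀, γ, hg₀, hug₀⟩ := hK u G N hu hG hN
  obtain ⟨g, hgm, hg, hgg⟩ := hg₀.exists_measurable
  have hug : u =ᵐ[volume] fun x => g ‖x‖ := by
    filter_upwards [hug₀, compl_mem_ae_iff.2 (measure_singleton (0 : R3))] with x hx hx0
    rw [hx, hgg x hx0]
  refine ⟨g, γ, hgm, hg, hug, RadialProfile.exists_abs_le_of_lintegral_ne_top fun htop => ?_⟩
  have h1 := lintegral_enorm_pow_six hgm hug
  rw [htop, ENNReal.mul_top sphereMeasure_ne_zero, lintegral_enorm_pow_six_eq] at h1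
  exact (ENNReal.pow_ne_top h6.eLpNorm_ne_top) h1

theorem sphereMeasure_univ_eq : sphereMeasure Set.univ = ENNReal.ofReal (sphereMeasure.real Set.univ) := by
  simp [measureReal_def]

/-- The Sobolev inequality for radial functions. -/
theorem exists_eLpNorm_six_le (K : ℝ≥0) : ∃ C : ℝ≥0, ∀ (u : R3 → ℝ) (g γ : ℝ → ℝ) (N : ℝ≥0),
    Measurable g → RadialProfile g γ (K * N) → (u =ᵐ[volume] fun x => g ‖x‖) →
      (∀ ε > 0, ∀ s, ∃ r, s ≤ r ∧ |g r| ≤ ε) → eLpNorm u 6 volume ≤ C * N := by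
  set c := sphereMeasure.real Set.univ with hc
  have hc0 : 0 < c := sphereMeasure_real_pos
  -- Taking the maximum with `1` gives `C ≤ C ^ 6`, which avoids a sixth root.
  set C : ℝ := max 1 (c * (6 * (K : ℝ) ^ 6)) with hC
  have hC1 : 1 ≤ C := le_max_left _ _
  have hC6 : c * (6 * (K : ℝ) ^ 6) ≤ C ^ 6 := (le_max_right _ _).trans (le_self_pow₀ hC1 (by norm_num))
  refine ⟨C.toNNReal, fun u g γ N hgm hg hug h0 => ?_⟩
  have h1 := lintegral_enorm_pow_six hgm hug
  rw [lintegral_enorm_pow_six_eq] at h1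
  have h2 : eLpNorm u 6 volume ^ 6 ≤ ((C.toNNReal : ℝ≥0∞) * N) ^ 6 := by
    rw [h1, sphereMeasure_univ_eq]
    calc _ ≤ ENNReal.ofReal c * ENNReal.ofReal (6 * ((K * N : ℝ≥0) : ℝ) ^ 6) := by
          gcongr
          exact hg.lintegral_pow_six_le h0
      _ = ENNReal.ofReal (c * (6 * (K : ℝ) ^ 6) * (N : ℝ) ^ 6) := by
          rw [← ENNReal.ofReal_mul hc0.le]; push_cast; congr 1; ring
      _ ≤ ENNReal.ofReal (C ^ 6 * (N : ℝ) ^ 6) := by gcongr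
      _ = ENNReal.ofReal ((C * N) ^ 6) := by rw [mul_pow]
      _ = _ := by
          rw [ENNReal.ofReal_pow (by positivity), ENNReal.ofReal_mul (by positivity), ENNReal.ofReal_coe_nnreal]
          rfl
  exact (ENNReal.pow_le_pow_left_iff (by norm_num)).1 h2

/-- One factor `g²` of `|g|^τ` is kept for the weighted integral, and the other `τ - 2` powers are
estimated by pointwise decay. The surplus exponent `κ` then comes out as a power of `R`. -/
theorem exists_eLpNorm_tail_le {a : ℝ} (ha : 0 < a) {τ : ℝ} (hτ : 18 / 7 < τ) (hτ6 : τ ≤ 6) (K : ℝ≥0) :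
    ∃ C : ℝ≥0, ∃ κ : ℝ, 0 < κ ∧
    ∀ (u : R3 → ℝ) (g γ : ℝ → ℝ) (N : ℝ≥0),
      AEMeasurable u → Measurable g → RadialProfile g γ (K * N) → (u =ᵐ[volume] fun x => g ‖x‖) →
      (∀ ε > 0, ∀ s, ∃ r, s ≤ r ∧ |g r| ≤ ε) → bpEnergySq a u ^ (1 / 2 : ℝ) ≤ (N : ℝ≥0∞) ^ 2 →
      ∀ R : ℝ, 1 ≤ R → eLpNorm ({x : R3 | R ≤ ‖x‖}.indicator u) (ENNReal.ofReal τ) volume ≤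
        ENNReal.ofReal (R ^ (-κ)) * (C * N) := by
  set c := sphereMeasure.real Set.univ with hc
  have hc0 : 0 < c := sphereMeasure_real_pos
  have hτ0 : 0 < τ := by linarith
  set θ := (τ - 2) / 2 with hθ
  have hθ0 : 0 < θ := by rw [hθ]; linarith
  -- The margin `(7/8)(τ - 2) - 1/2`, positive exactly when `τ > 18/7`, is set equal to `3ε`. Then
  -- `κ = 2ε - ε(τ - 2)/4 ≥ ε`, because `τ ≤ 6`.
  set ε := ((τ - 2) * (7 / 8) - 1 / 2) / 3 with hε
  have hε0 : 0 < ε := by rw [hε]; linarith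
  have hε1 : ε ≤ 7 / 2 := by rw [hε]; linarith
  set κ := (7 / 4 - ε / 2) * θ - 1 / 2 - ε with hκ
  have hκ0 : 0 < κ := by
    have h1 : ε * (τ - 2) ≤ ε * 4 := mul_le_mul_of_nonneg_left (by linarith) hε0.le
    have h2 : κ = 2 * ε - ε * (τ - 2) / 4 := by rw [hκ, hθ, hε]; ring
    linarith
  obtain ⟨C1, hC1⟩ := exists_lintegral_weight_le ha hε0
  set P : ℝ := 2 * K * √(C1 / c) with hP
  have hP0 : 0 ≤ P := by positivity
  refine ⟨((P ^ θ * C1) ^ (1 / τ)).toNNReal, κ / τ, by positivity, ?_⟩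
  intro u g γ N hu hgm hg hug h0 hV R hR
  have hR0 : 0 < R := by linarith
  have hwt : ∫⁻ x in {x : R3 | 1 ≤ ‖x‖}, ENNReal.ofReal (u x ^ 2 * ‖x‖ ^ (-(1 / 2) - ε)) ≤
      ENNReal.ofReal (C1 * (N : ℝ) ^ 2) := by
    refine (hC1 u hu).trans ?_
    rw [ENNReal.ofReal_mul C1.coe_nonneg, ENNReal.ofReal_coe_nnreal, ENNReal.ofReal_pow N.coe_nonneg, ENNReal.ofReal_coe_nnreal]
    gcongr
  have hW : ∫⁻ t in Set.Ioi 1, ENNReal.ofReal (g t ^ 2 * t ^ (3 / 2 - ε)) ≤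
      ENNReal.ofReal (C1 / c * (N : ℝ) ^ 2) := by
    have h1 := (lintegral_weight_profile hgm hug ε).trans hwt
    rw [sphereMeasure_univ_eq] at h1
    calc _ = ENNReal.ofReal c⁻¹ * (ENNReal.ofReal c *
          ∫⁻ t in Set.Ioi 1, ENNReal.ofReal (g t ^ 2 * t ^ (3 / 2 - ε))) := by
          rw [← mul_assoc, ← ENNReal.ofReal_mul (by positivity), inv_mul_cancel₀ hc0.ne',
            ENNReal.ofReal_one, one_mul]
      _ ≤ ENNReal.ofReal c⁻¹ * ENNReal.ofReal (C1 * (N : ℝ) ^ 2) := by gcongr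
      _ = _ := by rw [← ENNReal.ofReal_mul (by positivity)]; congr 1; ring
  have hdec : ∀ t, 1 ≤ t → g t ^ 2 ≤ P * (N : ℝ) ^ 2 * t ^ (-(7 / 4) + ε / 2) := by
    intro t ht
    refine (hg.sq_le_of_weighted h0 hε1 (by positivity) hW ht).trans_eq ?_
    rw [Real.sqrt_mul (by positivity), Real.sqrt_sq N.coe_nonneg, hP]
    push_cast
    ring
  have hpt : ∀ t, R ≤ t → |g t| ^ τ ≤
      (P * (N : ℝ) ^ 2) ^ θ * R ^ (-κ) * (g t ^ 2 * t ^ (-(1 / 2) - ε)) := by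
    intro t ht
    have ht0 : 0 < t := hR0.trans_le ht
    have e1 : |g t| ^ τ = (g t ^ 2) ^ θ * g t ^ 2 := by
      rw [← Real.rpow_add_one' (by positivity) (by positivity), ← sq_abs, ← Real.rpow_natCast,
        ← Real.rpow_mul (abs_nonneg _)]
      congr 1
      rw [hθ]; push_cast; ring
    have e2 : (g t ^ 2) ^ θ ≤ (P * (N : ℝ) ^ 2) ^ θ * (t ^ (-(1 / 2) - ε) * R ^ (-κ)) := by
      calc _ ≤ (P * (N : ℝ) ^ 2 * t ^ (-(7 / 4) + ε / 2)) ^ θ :=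
            Real.rpow_le_rpow (by positivity) (hdec t (hR.trans ht)) hθ0.le
        _ = (P * (N : ℝ) ^ 2) ^ θ * (t ^ (-(1 / 2) - ε) * t ^ (-κ)) := by
            rw [Real.mul_rpow (by positivity) (by positivity), ← Real.rpow_mul ht0.le, ← Real.rpow_add ht0]
            congr 2
            rw [hκ]; ring
        _ ≤ _ := by
            gcongr ?_ * (?_ * ?_)
            · exact Real.rpow_le_rpow_of_nonpos hR0 ht (by linarith)
    rw [e1]
    calc _ ≤ (P * (N : ℝ) ^ 2) ^ θ * (t ^ (-(1 / 2) - ε) * R ^ (-κ)) * g t ^ 2 := by gcongr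
      _ = _ := by ring
  have hS : MeasurableSet {x : R3 | R ≤ ‖x‖} := measurableSet_le measurable_const measurable_norm
  have hI : ∫⁻ x in {x : R3 | R ≤ ‖x‖}, ‖u x‖ₑ ^ τ ≤
      ENNReal.ofReal ((P * (N : ℝ) ^ 2) ^ θ * R ^ (-κ) * (C1 * (N : ℝ) ^ 2)) := by
    calc _ ≤ ∫⁻ x in {x : R3 | R ≤ ‖x‖}, ENNReal.ofReal ((P * (N : ℝ) ^ 2) ^ θ * R ^ (-κ)) *
            ENNReal.ofReal (u x ^ 2 * ‖x‖ ^ (-(1 / 2) - ε)) := by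
          refine lintegral_mono_ae ?_
          filter_upwards [ae_restrict_mem hS, ae_restrict_of_ae hug] with x hxR hx
          rw [hx, ← ENNReal.ofReal_mul (by positivity), Real.enorm_eq_ofReal_abs,
            ENNReal.ofReal_rpow_of_nonneg (abs_nonneg _) hτ0.le]
          exact ENNReal.ofReal_le_ofReal (hpt _ hxR)
      _ = ENNReal.ofReal ((P * (N : ℝ) ^ 2) ^ θ * R ^ (-κ)) * ∫⁻ x in {x : R3 | R ≤ ‖x‖},
            ENNReal.ofReal (u x ^ 2 * ‖x‖ ^ (-(1 / 2) - ε)) := lintegral_const_mul' _ _ (by simp)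
      _ ≤ ENNReal.ofReal ((P * (N : ℝ) ^ 2) ^ θ * R ^ (-κ)) * ENNReal.ofReal (C1 * (N : ℝ) ^ 2) := by
          gcongr
          exact (lintegral_mono_set fun x hx => hR.trans hx).trans hwt
      _ = _ := by rw [← ENNReal.ofReal_mul (by positivity)]
  rw [eLpNorm_indicator_eq_eLpNorm_restrict hS, eLpNorm_eq_lintegral_rpow_enorm_toReal (by simpa) (by simp),
    ENNReal.toReal_ofReal hτ0.le]
  calc _ ≤ ENNReal.ofReal ((P * (N : ℝ) ^ 2) ^ θ * R ^ (-κ) * (C1 * (N : ℝ) ^ 2)) ^ (1 / τ) := by gcongr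
    _ = ENNReal.ofReal (R ^ (-(κ / τ)) * ((P ^ θ * C1) ^ (1 / τ) * N)) := by
        rw [ENNReal.ofReal_rpow_of_nonneg (by positivity) (by positivity)]
        congr 1
        have e1 : ((N : ℝ) ^ 2) ^ θ * (N : ℝ) ^ 2 = (N : ℝ) ^ τ := by
          rw [← Real.rpow_add_one' (by positivity) (by positivity), ← Real.rpow_natCast,
            ← Real.rpow_mul N.coe_nonneg]
          congr 1
          rw [hθ]; push_cast; ring
        have e2 : (P * (N : ℝ) ^ 2) ^ θ * R ^ (-κ) * (C1 * (N : ℝ) ^ 2) =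
            R ^ (-κ) * ((P ^ θ * C1) * (N : ℝ) ^ τ) := by
          rw [Real.mul_rpow hP0 (by positivity), ← e1]; ring
        rw [e2, Real.mul_rpow (by positivity) (by positivity), Real.mul_rpow (by positivity) (by positivity),
          ← Real.rpow_mul hR0.le, ← Real.rpow_mul N.coe_nonneg, mul_one_div_cancel hτ0.ne', Real.rpow_one]
        congr 2
        ring
    _ = _ := by
        rw [ENNReal.ofReal_mul (by positivity), ENNReal.ofReal_mul (by positivity), ENNReal.ofReal_coe_nnreal]
        rfl

/-! ### Convergence of profiles and the embeddings -/

/-- An Arzelà–Ascoli argument: a compact product of intervals yields convergence at all positive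
rationals, and the common modulus of continuity transfers the Cauchy property to every `r > 0` from
a rational slightly below it. -/
theorem exists_tendsto_subseq_of_profile_bounds (g : ℕ → ℝ → ℝ) (C : ℝ)
    (h1 : ∀ n s r, 0 < s → s ≤ r → |g n r - g n s| ≤ C * √(s⁻¹ - r⁻¹))
    (h2 : ∀ n s, 0 < s → g n s ^ 2 ≤ C ^ 2 / s) :
    ∃ (k : ℕ → ℕ) (w : ℝ → ℝ), StrictMono k ∧ ∀ r, 0 < r → Tendsto (fun n => g (k n) r) atTop (𝓝 (w r)) := by
  let B : {q : ℚ // 0 < q} → Set ℝ := fun q => Set.Icc (-√(C ^ 2 / q)) (√(C ^ 2 / q))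
  have hB : IsCompact (Set.univ.pi B) := isCompact_univ_pi fun q => isCompact_Icc
  have hx : ∀ n, (fun q : {q : ℚ // 0 < q} => g n q) ∈ Set.univ.pi B := fun n q _ =>
    abs_le.1 (Real.abs_le_sqrt (h2 n q (by exact_mod_cast q.2)))
  obtain ⟨w₀, -, k, hk, hw₀⟩ := hB.tendsto_subseq hx
  rw [tendsto_pi_nhds] at hw₀
  have hcau : ∀ r, 0 < r → ∃ l, Tendsto (fun n => g (k n) r) atTop (𝓝 l) := by
    intro r hr
    refine cauchySeq_tendsto_of_complete (Metric.cauchySeq_iff.2 fun ε hε => ?_)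
    have hcont : Tendsto (fun s : ℝ => C * √(s⁻¹ - r⁻¹)) (𝓝 r) (𝓝 0) := by
      have : ContinuousAt (fun s : ℝ => C * √(s⁻¹ - r⁻¹)) r := by
        have := hr.ne'
        fun_prop (disch := assumption)
      simpa [ContinuousAt] using this
    obtain ⟨δ, hδ, hδ'⟩ := Metric.eventually_nhds_iff.1 (hcont.eventually (gt_mem_nhds (by positivity : 0 < ε / 3)))
    obtain ⟨q, hq1, hq2⟩ := exists_rat_btwn (show max 0 (r - δ) < r by simp [hr, hδ])
    have hq0 : (0 : ℝ) < q := (le_max_left _ _).trans_lt hq1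
    have hqδ : r - δ < q := (le_max_right _ _).trans_lt hq1
    have hs := hδ' (y := (q : ℝ)) (by rw [Real.dist_eq, abs_sub_comm, abs_of_pos (by linarith)]; linarith)
    have hcs := (hw₀ ⟨q, by exact_mod_cast hq0⟩).cauchySeq
    obtain ⟨M, hM⟩ := Metric.cauchySeq_iff.1 hcs (ε / 3) (by positivity)
    refine ⟨M, fun m hm n hn => ?_⟩
    have e1 := (h1 (k m) q r hq0 hq2.le).trans_lt hs
    have e2 := (h1 (k n) q r hq0 hq2.le).trans_lt hs
    have e3 := hM m hm n hn
    simp only [Function.comp_apply, Real.dist_eq] at e3 ⊢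
    rw [abs_lt] at *
    constructor <;> linarith [e1.1, e1.2, e2.1, e2.2, e3.1, e3.2]
  choose! w hw using hcau
  exact ⟨k, w, hk, hw⟩

/-- Hölder's inequality. It controls `L^τ` on the unit ball and, as the exponent of the measure is
positive for `τ < 6`, gives uniform integrability. -/
theorem eLpNorm_indicator_le_of_six {u : R3 → ℝ} (hu : AEStronglyMeasurable u volume) {τ : ℝ} (hτ0 : 0 < τ)
    (hτ6 : τ ≤ 6) {s : Set R3} (hs : MeasurableSet s) :
    eLpNorm (s.indicator u) (ENNReal.ofReal τ) volume ≤
      eLpNorm u 6 volume * volume s ^ (1 / τ - 1 / 6) := by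
  have h6 : (6 : ℝ≥0∞) = ENNReal.ofReal 6 := by simp
  rw [eLpNorm_indicator_eq_eLpNorm_restrict hs]
  have := eLpNorm_le_eLpNorm_mul_rpow_measure_univ (μ := volume.restrict s) (p := ENNReal.ofReal τ) (q := 6)
    (by rw [h6]; exact ENNReal.ofReal_le_ofReal hτ6) hu.restrict
  rw [Measure.restrict_apply_univ, ENNReal.toReal_ofReal hτ0.le, ENNReal.toReal_ofNat] at this
  refine this.trans ?_
  gcongr
  exact Measure.restrict_le_self

theorem hasWeakGradient_weakGradient {a : ℝ} {u : R3 → ℝ} (hu : u ∈ spaceEr a) :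
    HasWeakGradient u (weakGradient u) := by
  have hex : ∃ G, HasWeakGradient u G := hu.1.1.2.imp fun G h => h.1
  rw [weakGradient, dif_pos hex]
  exact hex.choose_spec

theorem energy_le_sq_of_normE_le {a : ℝ} {u : R3 → ℝ} {N : ℝ≥0} (hN : normE a u ≤ N) :
    eLpNorm (weakGradient u) 2 volume ^ 2 + bpEnergySq a u ^ (1 / 2 : ℝ) ≤ (N : ℝ≥0∞) ^ 2 := by
  have := ENNReal.rpow_le_rpow hN (show (0 : ℝ) ≤ 2 by norm_num)
  rw [normE, ← ENNReal.rpow_mul] at this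
  norm_num at this
  simpa using this

/-- The a priori estimates for a function of `𝓔_r` with weak gradient `G`. -/
theorem exists_radial_estimates {a : ℝ} (ha : 0 < a) {τ : ℝ} (hτ : 18 / 7 < τ) (hτ6 : τ ≤ 6) :
    ∃ C : ℝ≥0, ∃ κ : ℝ, 0 < κ ∧ ∀ (u : R3 → ℝ) (G : R3 → R3) (N : ℝ≥0), u ∈ spaceEr a →
      HasWeakGradient u G → eLpNorm G 2 volume ^ 2 + bpEnergySq a u ^ (1 / 2 : ℝ) ≤ (N : ℝ≥0∞) ^ 2 →
      eLpNorm u 6 volume ≤ C * N ∧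
      (∀ R : ℝ, 1 ≤ R → eLpNorm ({x : R3 | R ≤ ‖x‖}.indicator u) (ENNReal.ofReal τ) volume ≤
        ENNReal.ofReal (R ^ (-κ)) * (C * N)) ∧
      ∃ g : ℝ → ℝ, (u =ᵐ[volume] fun x => g ‖x‖) ∧
        (∀ s r, 0 < s → s ≤ r → |g r - g s| ≤ C * N * √(s⁻¹ - r⁻¹)) ∧
        ∀ s, 0 < s → g s ^ 2 ≤ (C * N) ^ 2 / s := by
  obtain ⟨K, hK⟩ := exists_measurable_radialProfile
  obtain ⟨C1, hC1⟩ := exists_eLpNorm_six_le K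
  obtain ⟨C2, κ, hκ, hC2⟩ := exists_eLpNorm_tail_le ha hτ hτ6 K
  have hC1' : C1 ≤ C1 + C2 + K := by rw [add_assoc]; exact le_self_add
  have hC2' : C2 ≤ C1 + C2 + K := by rw [add_right_comm]; exact le_add_self
  have hC3' : K ≤ C1 + C2 + K := le_add_self
  refine ⟨C1 + C2 + K, κ, hκ, fun u G N hu hwg hsum => ?_⟩
  have h6 : MemLp u 6 volume := hu.1.1.1
  have hN1 : eLpNorm G 2 volume ≤ N :=
    (ENNReal.pow_le_pow_left_iff two_ne_zero).1 (le_self_add.trans hsum)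
  obtain ⟨g, γ, hgm, hg, hug, h0⟩ := hK u G N hu.2 h6 hwg hN1
  have hKN : ((K * N : ℝ≥0) : ℝ) ≤ ((C1 + C2 + K : ℝ≥0) : ℝ) * N := by
    rw [NNReal.coe_mul]; gcongr
  refine ⟨(hC1 u g γ N hgm hg hug h0).trans (by gcongr), fun R hR => ?_, g, hug, fun s r hs hr => ?_,
    fun s hs => ?_⟩
  · exact (hC2 u g γ N h6.aestronglyMeasurable.aemeasurable hgm hg hug h0 (le_add_self.trans hsum) R hR).trans
      (by gcongr)
  · exact (hg.abs_sub_le hs hr).trans (by gcongr)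
  · exact (hg.sq_le_div h0 hs).trans (by gcongr)

theorem continuouslyEmbedsInLp_spaceEr {a : ℝ} (ha : 0 < a) {τ : ℝ} (hτ : 18 / 7 < τ) (hτ6 : τ ≤ 6) :
    ContinuouslyEmbedsInLp (spaceEr a) (normE a) τ := by
  have hτ0 : 0 < τ := by linarith
  have hp1 : 1 ≤ ENNReal.ofReal τ := by
    rw [← ENNReal.ofReal_one]; exact ENNReal.ofReal_le_ofReal (by linarith)
  obtain ⟨C, κ, hκ, hC⟩ := exists_radial_estimates ha hτ hτ6
  set B : Set R3 := {x : R3 | 1 ≤ ‖x‖} with hB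
  have hBm : MeasurableSet B := measurableSet_le measurable_const measurable_norm
  have hBc : Bᶜ = Metric.ball (0 : R3) 1 := by ext x; simp [hB]
  have hv : volume Bᶜ ^ (1 / τ - 1 / 6) ≠ ⊤ := by
    rw [hBc]
    refine ENNReal.rpow_ne_top_of_nonneg ?_ measure_ball_lt_top.ne
    rw [sub_nonneg]
    exact one_div_le_one_div_of_le hτ0 hτ6
  -- The bound is stated for an arbitrary weak gradient, so that uniqueness of weak gradients is
  -- never needed.
  have hb : ∀ u ∈ spaceEr a, ∀ G, HasWeakGradient u G → ∀ N : ℝ≥0,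
      eLpNorm G 2 volume ^ 2 + bpEnergySq a u ^ (1 / 2 : ℝ) ≤ (N : ℝ≥0∞) ^ 2 →
      eLpNorm u (ENNReal.ofReal τ) volume ≤
        ((C * (volume Bᶜ ^ (1 / τ - 1 / 6)).toNNReal + C + 1 : ℝ≥0) : ℝ≥0∞) * N := by
    intro u hu G hG N hN
    obtain ⟨h6, ht, -⟩ := hC u G N hu hG hN
    have hum : AEStronglyMeasurable u volume := hu.1.1.1.aestronglyMeasurable
    have h1 := ht 1 le_rfl
    simp only [Real.one_rpow, ENNReal.ofReal_one, one_mul] at h1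
    calc eLpNorm u (ENNReal.ofReal τ) volume
        = eLpNorm (Bᶜ.indicator u + B.indicator u) (ENNReal.ofReal τ) volume := by
          rw [add_comm, Set.indicator_self_add_compl]
      _ ≤ eLpNorm (Bᶜ.indicator u) (ENNReal.ofReal τ) volume +
          eLpNorm (B.indicator u) (ENNReal.ofReal τ) volume :=
          eLpNorm_add_le (hum.indicator hBm.compl) (hum.indicator hBm) hp1
      _ ≤ C * N * volume Bᶜ ^ (1 / τ - 1 / 6) + C * N := by
          gcongr
          exact (eLpNorm_indicator_le_of_six hum hτ0 hτ6 hBm.compl).trans (by gcongr)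
      _ ≤ C * N * volume Bᶜ ^ (1 / τ - 1 / 6) + C * N + N := le_self_add
      _ = _ := by
          push_cast
          rw [ENNReal.coe_toNNReal hv]
          ring
  refine ⟨fun u hu => ⟨hu.1.1.1.aestronglyMeasurable, ?_⟩,
    C * (volume Bᶜ ^ (1 / τ - 1 / 6)).toNNReal + C + 1, fun u hu => ?_⟩
  -- `weakGradient u` is an arbitrary choice that has not been shown to lie in `L²`; membership
  -- therefore uses a square-integrable weak gradient provided by `D12`.
  · obtain ⟨G, hG, hG2⟩ := hu.1.1.2
    set X := eLpNorm G 2 volume ^ 2 + bpEnergySq a u ^ (1 / 2 : ℝ) with hX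
    have hXtop : X ≠ ⊤ := ENNReal.add_ne_top.2 ⟨ENNReal.pow_ne_top hG2.eLpNorm_ne_top,
      ENNReal.rpow_ne_top_of_nonneg (by norm_num) hu.1.2.ne⟩
    refine (hb u hu G hG (NNReal.sqrt X.toNNReal) ?_).trans_lt
      (ENNReal.mul_lt_top ENNReal.coe_lt_top ENNReal.coe_lt_top)
    rw [← ENNReal.coe_pow, NNReal.sq_sqrt, ENNReal.coe_toNNReal hXtop]
  -- The summand `1` keeps the constant nonzero, so the bound is trivial when the norm is infinite.
  · by_cases htop : normE a u = ⊤
    · rw [htop, ENNReal.mul_top (by simp)]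
      exact le_top
    · have := hb u hu _ (hasWeakGradient_weakGradient hu) (normE a u).toNNReal
        (energy_le_sq_of_normE_le (by rw [ENNReal.coe_toNNReal htop]))
      rwa [ENNReal.coe_toNNReal htop] at this

theorem compactlyEmbedsInLp_spaceEr {a : ℝ} (ha : 0 < a) {τ : ℝ} (hτ : 18 / 7 < τ) (hτ6 : τ < 6) :
    CompactlyEmbedsInLp (spaceEr a) (normE a) τ := by
  have hcont := continuouslyEmbedsInLp_spaceEr ha hτ hτ6.le
  refine ⟨hcont, fun u hu ⟨M, hM⟩ => ?_⟩
  have hτ0 : 0 < τ := by linarith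
  have hp1 : 1 ≤ ENNReal.ofReal τ := by
    rw [← ENNReal.ofReal_one]; exact ENNReal.ofReal_le_ofReal (by linarith)
  obtain ⟨C, κ, hκ, hC⟩ := exists_radial_estimates ha hτ hτ6.le
  have hest := fun n => hC (u n) _ M (hu n) (hasWeakGradient_weakGradient (hu n))
    (energy_le_sq_of_normE_le (hM n))
  choose h6 ht g hug hg1 hg2 using hest
  have hum : ∀ n, AEStronglyMeasurable (u n) volume := fun n => (hu n).1.1.1.aestronglyMeasurable
  obtain ⟨k, w, hk, hw⟩ := exists_tendsto_subseq_of_profile_bounds g (C * M) hg1 hg2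
  have hae : ∀ᵐ x : R3, Tendsto (fun n => u (k n) x) atTop (𝓝 (w ‖x‖)) := by
    filter_upwards [ae_all_iff.2 hug, compl_mem_ae_iff.2 (measure_singleton (0 : R3))] with x hx hx0
    simp only [hx]
    exact hw _ (norm_pos_iff.2 hx0)
  have hwm : AEStronglyMeasurable (fun x : R3 => w ‖x‖) volume :=
    aestronglyMeasurable_of_tendsto_ae atTop (fun n => hum (k n)) hae
  -- Fatou's lemma, with the uniform `L^τ` bound from the continuous embedding.
  have hwL : MemLp (fun x : R3 => w ‖x‖) (ENNReal.ofReal τ) volume := by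
    obtain ⟨C', hC'⟩ := hcont.2
    refine ⟨hwm, (Lp.eLpNorm_lim_le_liminf_eLpNorm (fun n => hum (k n)) _ hae).trans_lt ?_⟩
    refine (liminf_le_of_le (a := (C' : ℝ≥0∞) * M) (by isBoundedDefault) fun b hb => ?_).trans_lt
      (ENNReal.mul_lt_top ENNReal.coe_lt_top ENNReal.coe_lt_top)
    obtain ⟨n, hn⟩ := hb.exists
    refine hn.trans ((hC' _ (hu (k n))).trans ?_)
    gcongr
    exact hM (k n)
  -- Vitali's convergence theorem; uniform integrability and uniform tightness remain.
  refine ⟨k, fun x => w ‖x‖, hk, hwL, tendsto_Lp_of_tendsto_ae hp1 (by simp) (fun n => hum (k n)) hwL ?_ ?_ hae⟩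
  · intro ε hε
    set e := 1 / τ - 1 / 6 with he
    have he0 : 0 < e := by
      rw [he, sub_pos]
      exact one_div_lt_one_div_of_lt hτ0 hτ6
    -- The added `1` keeps `b` positive; the choice `δ = (ε / b)^{1/e}` makes `b δ^e = ε`.
    set b : ℝ := C * M + 1 with hb
    have hb0 : 0 < b := by positivity
    refine ⟨(ε / b) ^ (1 / e), by positivity, fun n s hs hvs => ?_⟩
    calc _ ≤ eLpNorm (u (k n)) 6 volume * volume s ^ e := eLpNorm_indicator_le_of_six (hum _) hτ0 hτ6.le hs
      _ ≤ ENNReal.ofReal b * ENNReal.ofReal ((ε / b) ^ (1 / e)) ^ e := by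
          gcongr
          refine (h6 (k n)).trans ?_
          rw [← ENNReal.coe_mul, ← ENNReal.ofReal_coe_nnreal, NNReal.coe_mul]
          exact ENNReal.ofReal_le_ofReal (by linarith)
      _ = ENNReal.ofReal ε := by
          rw [ENNReal.ofReal_rpow_of_nonneg (by positivity) he0.le, ← ENNReal.ofReal_mul hb0.le,
            ← Real.rpow_mul (by positivity), one_div_mul_cancel he0.ne', Real.rpow_one, mul_div_cancel₀ _ hb0.ne']
  · intro ε hε
    have hlim : Tendsto (fun R : ℝ => R ^ (-κ) * (C * M)) atTop (𝓝 0) := by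
      simpa using (tendsto_rpow_neg_atTop hκ).mul_const ((C : ℝ) * M)
    obtain ⟨R, hR1, hR⟩ := ((eventually_ge_atTop 1).and
      (hlim.eventually (gt_mem_nhds (show (0 : ℝ) < ε from hε)))).exists
    refine ⟨Metric.ball 0 R, measure_ball_lt_top.ne, fun n => ?_⟩
    have hBc : (Metric.ball (0 : R3) R)ᶜ = {x : R3 | R ≤ ‖x‖} := by ext x; simp
    rw [hBc]
    refine (ht (k n) R hR1).trans ?_
    rw [← ENNReal.coe_mul, ← ENNReal.ofReal_coe_nnreal, NNReal.coe_mul, ← ENNReal.ofReal_mul (by positivity),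
      ← ENNReal.ofReal_coe_nnreal]
    exact ENNReal.ofReal_le_ofReal hR.le

theorem mainTheorem4 (a : ℝ) (ha : 0 < a) :
    (∀ τ : ℝ, 18 / 7 < τ → τ ≤ 6 → ContinuouslyEmbedsInLp (spaceEr a) (normE a) τ) ∧
      (∀ τ : ℝ, 18 / 7 < τ → τ < 6 → CompactlyEmbedsInLp (spaceEr a) (normE a) τ) :=
  ⟨fun _ h1 h2 => continuouslyEmbedsInLp_spaceEr ha h1 h2,
    fun _ h1 h2 => compactlyEmbedsInLp_spaceEr ha h1 h2⟩
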